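/- **Conventions.** A circuit class $\mathcal C$ is *typical* if $\mathcal C \in \{\mathrm{AC}^0, \mathrm{ACC}, \mathrm{TC}^0, \mathrm{NC}^1, \mathrm{NC}, \mathrm{P/poly}\}$ (non-uniform). The size of a circuit is its number of gates. If the depth of $\mathcal C$-circuits is restricted, the bound is given by a parameter $d \in \mathbb N$: depth at most $d$ for $\mathrm{AC}^0, \mathrm{ACC}, \mathrm{TC}^0$, at most $d\log n$ for $\mathrm{NC}^1$, at most $(\log n)^d$ for $\mathrm{NC}$, on $n$ inputs; for $\mathrm{ACC}$ there is also a modulus $m \ge 1$ for the MOD gates. A property of Boolean functions is a set $\mathcal P$ of Boolean functions $f:\{0,1\}^n\to\{0,1\}$, $n \in \mathbb N$. For a complexity class $\Gamma$, $\mathcal P$ is a *$\Gamma$-natural property useful against $\mathcal C$* if * (Constructivity) the language over $\{0,1\}$ consisting of the truth tables (of length $2^n$) of the functions in $\mathcal P$ is in $\Gamma$; * (Largeness) there is a constant $c$ such that, for all $n$, $\mathcal P$ contains at least a $1/2^{c(n+1)}$ fraction of all functions $f:\{0,1\}^n\to\{0,1\}$; * (Usefulness) for every sequence $(f_n)_{n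 \in \mathbb N}$ with $f_n : \{0,1\}^n \to \{0,1\}$ and $f_n\in\mathcal P$ for all $n$, and for all $k$ (and all values of the parameters $d$, $m$ that $\mathcal C$ has), there are infinitely many $n$ such that $f_n$ does not have $\mathcal C$-circuits of size $n^k$ (with these $d$, $m$). Here $\mathrm P$ is deterministic polynomial time, and $\mathrm{RP}$ is randomized polynomial time with one-sided error: inputs in the language are accepted with probability at least $2/3$, inputs outside of it are never accepted. **Theorem.** Let $\mathcal C$ be a typical circuit class. If there exists an $\mathrm{RP}$-natural property useful against $\mathcal C$, then there exists a $\mathrm P$-natural property useful against $\mathcal C$. -/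

import Mathlib

/-! ### Boolean functions and their truth tables -/

/-- Boolean functions on `n` bits. -/
abbrev BoolFun (n : ℕ) : Type := (Fin n → Bool) → Bool

/-- The truth table `f(y₁) f(y₂) ⋯ f(y_{2ⁿ})`, with `y₁, y₂, …` the `n`-bit strings in
lexicographic order. -/
def truthTable : (n : ℕ) → BoolFun n → List Bool
  | 0, f => [f Fin.elim0]
  | n + 1, f =>
      truthTable n (fun y => f (Fin.cons false y)) ++ truthTable n (fun y => f (Fin.cons true y))

/-- A property of Boolean functions: a set of Boolean functions, given by its `n`-bit members
for every `n`. -/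
abbrev BoolProperty : Type := (n : ℕ) → Set (BoolFun n)

/-- The language over `{0,1}` that consists of the truth tables of the members of a property. -/
def truthTableLanguage (P : BoolProperty) : Language Bool :=
  {w | ∃ n, ∃ f ∈ P n, w = truthTable n f}

/-! ### The complexity classes `P` and `RP`

Polynomial time is measured in steps of (multi-stack) Turing machines. -/

/-- `P`: the languages that are decided by a deterministic polynomial-time Turing machine. -/
def classP : Set (Language Bool) :=
  {L | ∃ A : List Bool → Bool,
    Nonempty (Turing.TM2ComputableInPolyTime (fun w : List Bool => w) Computability.encodeBool A) ∧
    ∀ x, x ∈ L ↔ A x = true}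

/-- `RP`: the languages `L` with a polynomial-time machine `A` that takes an input `x` and
`q(|x|)` random bits `r`, for a polynomial `q`, such that `A` accepts with probability at least
`2/3` if `x ∈ L`, and `A` rejects for every choice of the random bits if `x ∉ L`. -/
def classRP : Set (Language Bool) :=
  {L | ∃ (A : List Bool × List Bool → Bool) (q : Polynomial ℕ),
    Nonempty (Turing.TM2ComputableInPolyTime
      (Computability.encodingProd (Computability.encodingList Bool)
        (Computability.encodingList Bool)).encode Computability.encodeBool A) ∧
    ∀ x : List Bool,
      (x ∈ L → (2 / 3 : ℝ) * 2 ^ q.eval x.length ≤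
        (Finset.univ.filter fun r : Fin (q.eval x.length) → Bool =>
          A (x, List.ofFn r) = true).card) ∧
      (x ∉ L → ∀ r : Fin (q.eval x.length) → Bool, A (x, List.ofFn r) = false)}

/-! ### Boolean circuits -/

/-- Gate types. -/
inductive GateType where
  | not
  | and
  | or
  | mod (m : ℕ)
  | maj

/-- The output of a gate on the list of its input values. A `MOD_m` gate outputs `1` iff the
number of ones among its inputs is divisible by `m`; a majority gate outputs `1` iff at least
half of its inputs are ones. A negation gate is only ever used with exactly one input. -/
def GateType.eval : GateType → List Bool → Bool
  | .not, l => l.all fun b => !b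
  | .and, l => l.all fun b => b
  | .or, l => l.any fun b => b
  | .mod m, l => decide (m ∣ l.count true)
  | .maj, l => decide (l.length ≤ 2 * l.count true)

/-- What can be plugged into a gate, in a circuit on `n` inputs: a constant, an input variable,
or the output of one of the first `s` gates. -/
inductive Wire (n s : ℕ) where
  | const (b : Bool)
  | input (i : Fin n)
  | gate (j : Fin s)

/-- A Boolean circuit on `n` inputs: a directed acyclic graph of gates, listed in a topological
order. Its size is its number of gates. -/
structure Circuit (n : ℕ) where
  /-- the number of gates -/
  size : ℕ
  /-- the type of each gate -/
  type : Fin size → GateType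
  /-- what is plugged into each gate; gate `i` may only use earlier gates -/
  args : (i : Fin size) → List (Wire n i)
  /-- where the output of the circuit is read -/
  output : Wire n size
  /-- negation gates have fan-in one -/
  not_fanIn : ∀ i, type i = .not → (args i).length = 1
  /-- no input variable and no gate is plugged twice into the same gate -/
  no_repeat : ∀ i, (args i).Pairwise fun v w => v = w → ∃ b, v = .const b

namespace Circuit

variable {n : ℕ}

/-- The value that gate `i` computes on input `x`. -/
def gateValue (C : Circuit n) (x : Fin n → Bool) (i : Fin C.size) : Bool :=
  (C.type i).eval ((C.args i).map fun w =>
    match w with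
    | .const b => b
    | .input k => x k
    | .gate j => C.gateValue x ⟨j, j.2.trans i.2⟩)
  termination_by i.val
  decreasing_by exact j.2

/-- The function that the circuit computes. -/
def eval (C : Circuit n) : BoolFun n := fun x =>
  match C.output with
  | .const b => b
  | .input k => x k
  | .gate j => C.gateValue x j

/-- The largest number of gates on a path that ends in gate `i`. -/
def gateDepth (C : Circuit n) (i : Fin C.size) : ℕ :=
  ((C.args i).map fun w =>
    match w with
    | .const _ => 0
    | .input _ => 0
    | .gate j => C.gateDepth ⟨j, j.2.trans i.2⟩).foldr max 0 + 1
  termination_by i.val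
  decreasing_by exact j.2

/-- The depth of a circuit: the largest number of gates on a path that ends in the output. -/
def depth (C : Circuit n) : ℕ :=
  match C.output with
  | .const _ => 0
  | .input _ => 0
  | .gate j => C.gateDepth j

/-- All gates are of one of the types in `S`. -/
def HasBasis (C : Circuit n) (S : Set GateType) : Prop := ∀ i, C.type i ∈ S

/-- All gates have fan-in at most two. -/
def FanInTwo (C : Circuit n) : Prop := ∀ i, (C.args i).length ≤ 2

end Circuit

/-! ### The typical circuit classes -/

/-- The names of the (non-uniform) circuit classes `AC⁰`, `ACC`, `TC⁰`, `NC¹`, `NC`, `P/poly`. -/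
inductive TypicalClass where
  | AC0
  | ACC
  | TC0
  | NC1
  | NC
  | PPoly

/-- The circuits of a typical class, for the depth parameter `d` and the modulus `m`, where the
class has such parameters. The depth bound is `d` for `AC⁰`, `ACC` and `TC⁰`; it is `d log n` for
`NC¹` and `(log n)ᵈ` for `NC`. -/
def TypicalClass.IsCircuit (d m : ℕ) {n : ℕ} (C : Circuit n) : TypicalClass → Prop
  | .AC0 => C.HasBasis {.not, .and, .or} ∧ C.depth ≤ d
  | .ACC => C.HasBasis {.not, .and, .or, .mod m} ∧ C.depth ≤ d
  | .TC0 => C.HasBasis {.not, .and, .or, .maj} ∧ C.depth ≤ d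
  | .NC1 => C.HasBasis {.not, .and, .or} ∧ C.FanInTwo ∧ C.depth ≤ d * Nat.log 2 n
  | .NC => C.HasBasis {.not, .and, .or} ∧ C.FanInTwo ∧ C.depth ≤ Nat.log 2 n ^ d
  | .PPoly => C.HasBasis {.not, .and, .or} ∧ C.FanInTwo

/-- `f` has circuits of size at most `s` of the class `𝒞`, with depth parameter `d` and
modulus `m`. -/
def TypicalClass.HasCircuit (𝒞 : TypicalClass) (d m s : ℕ) {n : ℕ} (f : BoolFun n) : Prop :=
  ∃ C : Circuit n, 𝒞.IsCircuit d m C ∧ C.size ≤ s ∧ C.eval = f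

/-! ### Natural properties -/

/-- Largeness: for all `n`, the property contains a `1/2^{O(n)}` fraction of all `n`-bit
functions. The exponent is `c (n + 1)`, so that there is no exception at `n = 0`. -/
def IsLarge (P : BoolProperty) : Prop :=
  ∃ c : ℕ, ∀ n : ℕ,
    (1 / 2 ^ (c * (n + 1)) : ℝ) * Nat.card (BoolFun n) ≤ (P n).ncard

/-- Usefulness: if `f n ∈ P` for all `n`, then for all `k`, and all choices of the depth
parameter and the modulus, there are infinitely many `n` for which `f n` does not have `𝒞`-circuits
of size `nᵏ`. -/
def IsUseful (𝒞 : TypicalClass) (P : BoolProperty) : Prop :=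
  ∀ f : (n : ℕ) → BoolFun n, (∀ n, f n ∈ P n) →
    ∀ k d m : ℕ, 0 < m → ∃ᶠ n in Filter.atTop, ¬ 𝒞.HasCircuit d m (n ^ k) (f n)

/-- `P` is a `Γ`-natural property useful against `𝒞`. -/
structure IsNaturalProperty (Γ : Set (Language Bool)) (𝒞 : TypicalClass) (P : BoolProperty) :
    Prop where
  constructive : truthTableLanguage P ∈ Γ
  large : IsLarge P
  useful : IsUseful 𝒞 P

/-! A truth table on `m` inputs has `2 ^ m` bits, enough to contain both a truth table on `n = m /
K` inputs and the random bits that the `RP` machine `A` wants for it, if `K` exceeds the degree of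
the polynomial `q` that counts these bits (`exists_pow_add_eval_le`). Let the new property hold for
`f` if `A` accepts the initial segment of length `2 ^ n` of its table with the bits that follow as
random bits, and also if the table is too short for this.

Largeness: a table in the new property arises from a member of the old one on `n` inputs, an
accepting random string, and arbitrary padding. So the density drops by a factor of at most `2/3`
(`card_mul_le_ncard_prefixProperty`).

Usefulness: the initial segment is the truth table of a restriction of `f`, with the leading inputs
fixed to `false`, and a restriction has circuits no larger or deeper than `f`
(`exists_restriction`). Since `A` has no false positives, a single accepting string certifies that
the restriction is in the old property. A polynomial bound in `K * n` is one in `n`, so lower bounds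
for the restrictions give lower bounds for `f` on `K * n` inputs (`isUseful_prefixProperty`).

Constructivity: no randomness is left, and splitting the input is easy. Most of the formal work is
an explicit stack machine that does the splitting and then runs the machine of `A`
(`exists_runs_parse`, `truthTableLanguage_prefixProperty_mem_classP`). -/

/-! ### A structured language for stack machines

Programs that prepare the input of a given machine `tm`. They use the stacks of `tm`, onto which
they only push, and further stacks of bits, indexed by `κ`. -/

namespace StackProgram

open Turing StateTransition

/-- The stack alphabets: those of `tm`, and bits for the further stacks. -/
@[reducible] def Alphabet (tm : FinTM2) (κ : Type) : tm.K ⊕ κ → Type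
  | .inl k => tm.Γ k
  | .inr _ => Bool

/-- The contents of the stacks of `tm` and of the further stacks. -/
abbrev Memory (tm : FinTM2) (κ : Type) : Type :=
  (∀ k, List (tm.Γ k)) × (κ → List Bool)

/-- All stack contents as one family. -/
def Memory.stacks {tm : FinTM2} {κ : Type} (s : Memory tm κ) :
    ∀ k : tm.K ⊕ κ, List (Alphabet tm κ k)
  | .inl k => s.1 k
  | .inr k => s.2 k

/-- Structured programs. -/
inductive Prog (tm : FinTM2) (κ : Type) : Type where
  | skip
  /-- push onto a stack of `tm` -/
  | emit (k : tm.K) (a : tm.Γ k)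
  /-- push onto a stack of bits -/
  | put (k : κ) (b : Bool)
  | seq (p q : Prog tm κ)
  /-- pop a bit and branch on the result -/
  | pop (k : κ) (p : Option Bool → Prog tm κ)
  /-- while the stack is nonempty, pop a bit and execute the body -/
  | loop (k : κ) (p : Bool → Prog tm κ)

namespace Prog

variable {tm : FinTM2} {κ : Type}

/-- The labels of the machine code of a program. -/
inductive Pos : Prog tm κ → Type
  | skip : Pos .skip
  | emit {k a} : Pos (.emit k a)
  | put {k b} : Pos (.put k b)
  | seqLeft {p q} : Pos p → Pos (.seq p q)
  | seqRight {p q} : Pos q → Pos (.seq p q)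
  | pop {k p} : Pos (.pop k p)
  | popBody {k p} (o : Option Bool) : Pos (p o) → Pos (.pop k p)
  | loop {k p} : Pos (.loop k p)
  | loopBody {k p} (b : Bool) : Pos (p b) → Pos (.loop k p)

instance finite_pos (p : Prog tm κ) : Finite (Pos p) := by
  induction p with
  | skip => exact Finite.of_surjective (fun _ : Unit => .skip) fun | .skip => ⟨(), rfl⟩
  | emit k a => exact Finite.of_surjective (fun _ : Unit => .emit) fun | .emit => ⟨(), rfl⟩
  | put k b => exact Finite.of_surjective (fun _ : Unit => .put) fun | .put => ⟨(), rfl⟩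
  | seq p q =>
    exact Finite.of_surjective (Sum.elim (α := Pos p) (β := Pos q) .seqLeft .seqRight) fun
      | .seqLeft l => ⟨.inl l, rfl⟩
      | .seqRight l => ⟨.inr l, rfl⟩
  | pop k p =>
    exact Finite.of_surjective
      (fun l : Option (Σ o, Pos (p o)) => l.elim Pos.pop fun l => .popBody l.1 l.2) fun
      | .pop => ⟨none, rfl⟩
      | .popBody o l => ⟨some ⟨o, l⟩, rfl⟩
  | loop k p =>
    exact Finite.of_surjective
      (fun l : Option (Σ b, Pos (p b)) => l.elim Pos.loop fun l => .loopBody l.1 l.2) fun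
      | .loop => ⟨none, rfl⟩
      | .loopBody b l => ⟨some ⟨b, l⟩, rfl⟩

/-- The label at which a program starts. -/
def entry : ∀ p : Prog tm κ, Pos p
  | .skip => .skip
  | .emit _ _ => .emit
  | .put _ _ => .put
  | .seq p _ => .seqLeft (entry p)
  | .pop _ _ => .pop
  | .loop _ _ => .loop

/-- The machine code of a program whose labels are embedded by `e`, and which continues at the
label `exit`. The second component of the internal state holds the last bit popped. -/
def code {Λ : Type} : ∀ {p : Prog tm κ}, (Pos p → Λ) → Λ → Pos p →
    TM2.Stmt (Alphabet tm κ) Λ (tm.σ × Option Bool)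
  | .skip, _, exit, .skip => .goto fun _ => exit
  | .emit k a, _, exit, .emit => .push (.inl k) (fun _ => a) (.goto fun _ => exit)
  | .put k b, _, exit, .put => .push (.inr k) (fun _ => b) (.goto fun _ => exit)
  | .seq _ q, e, _, .seqLeft l => code (fun l => e (.seqLeft l)) (e (.seqRight (entry q))) l
  | .seq _ _, e, exit, .seqRight l => code (fun l => e (.seqRight l)) exit l
  | .pop k p, e, _, .pop =>
      .pop (.inr k) (fun v o => (v.1, o)) (.goto fun v => e (.popBody v.2 (entry (p v.2))))
  | .pop _ _, e, exit, .popBody o l => code (fun l => e (.popBody o l)) exit l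
  | .loop k p, e, exit, .loop =>
      .pop (.inr k) (fun v o => (v.1, o))
        (.goto fun v => v.2.elim exit fun b => e (.loopBody b (entry (p b))))
  | .loop _ _, e, _, .loopBody b l => code (fun l => e (.loopBody b l)) (e .loop) l

variable [DecidableEq κ]

/-- `Runs p s s' t`: the program `p`, started on `s`, ends on `s'` within `t` steps. -/
inductive Runs : Prog tm κ → Memory tm κ → Memory tm κ → ℕ → Prop
  | skip (s) : Runs .skip s s 1
  | emit (k a s) : Runs (.emit k a) s (Function.update s.1 k (a :: s.1 k), s.2) 1
  | put (k b s) : Runs (.put k b) s (s.1, Function.update s.2 k (b :: s.2 k)) 1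
  | seq {p q s₀ s₁ s₂ t₁ t₂} : Runs p s₀ s₁ t₁ → Runs q s₁ s₂ t₂ →
      Runs (.seq p q) s₀ s₂ (t₁ + t₂)
  | pop {k p s s' t} : Runs (p (s.2 k).head?) (s.1, Function.update s.2 k (s.2 k).tail) s' t →
      Runs (.pop k p) s s' (t + 1)
  | loop_nil {k p s} : s.2 k = [] → Runs (.loop k p) s s 1
  | loop_cons {k p s s₁ s₂ b l t₁ t₂} : s.2 k = b :: l →
      Runs (p b) (s.1, Function.update s.2 k l) s₁ t₁ → Runs (.loop k p) s₁ s₂ t₂ →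
      Runs (.loop k p) s s₂ (t₁ + t₂ + 1)
  -- This makes the last index an upper bound, so that running times need not be tracked exactly.
  | mono {p s s' t t'} : Runs p s s' t → t ≤ t' → Runs p s s' t'

theorem update_inl (s : Memory tm κ) (k : tm.K) (x : List (tm.Γ k)) :
    Function.update s.stacks (.inl k) x = Memory.stacks (Function.update s.1 k x, s.2) := by
  funext k'
  rcases k' with k' | k'
  · rcases eq_or_ne k' k with rfl | h
    · simp [Memory.stacks]
    · simp [Memory.stacks, h]
  · simp [Memory.stacks]

theorem update_inr (s : Memory tm κ) (k : κ) (x : List Bool) :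
    Function.update s.stacks (.inr k) x = Memory.stacks (s.1, Function.update s.2 k x) := by
  funext k'
  rcases k' with k' | k'
  · simp [Memory.stacks]
  · rcases eq_or_ne k' k with rfl | h
    · simp [Memory.stacks]
    · simp [Memory.stacks, h]

/-- Machine code simulates the program. -/
theorem Runs.steps {Λ : Type} {M : Λ → TM2.Stmt (Alphabet tm κ) Λ (tm.σ × Option Bool)}
    {p : Prog tm κ} {s s' : Memory tm κ} {t : ℕ} (h : Runs p s s' t) :
    ∀ (e : Pos p → Λ) (exit : Λ), (∀ l, M (e l) = code e exit l) → ∀ (v : tm.σ) (o : Option Bool),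
      ∃ t' ≤ t, ∃ o', (flip bind (TM2.step M))^[t'] (some ⟨some (e (entry p)), (v, o), s.stacks⟩) =
        some ⟨some exit, (v, o'), s'.stacks⟩ := by
  induction h with
  | skip s =>
    intro e exit hM v o
    refine ⟨1, le_rfl, o, ?_⟩
    simp [flip, hM, code, entry]
  | emit k a s =>
    intro e exit hM v o
    refine ⟨1, le_rfl, o, ?_⟩
    simp [flip, hM, ← update_inl]
    rfl
  | put k b s =>
    intro e exit hM v o
    refine ⟨1, le_rfl, o, ?_⟩
    simp [flip, hM, ← update_inr]
    rfl
  | @seq p q s₀ s₁ s₂ t₁ t₂ _ _ ih₁ ih₂ =>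
    intro e exit hM v o
    obtain ⟨u₁, hu₁, o₁, h₁⟩ := ih₁ (fun l => e (.seqLeft l)) (e (.seqRight (entry q)))
      (fun l => by rw [hM, code]) v o
    obtain ⟨u₂, hu₂, o₂, h₂⟩ := ih₂ (fun l => e (.seqRight l)) exit (fun l => by rw [hM, code]) v o₁
    -- In an iterate of order `u₂ + u₁`, the right summand is executed first.
    refine ⟨u₂ + u₁, by omega, o₂, ?_⟩
    rw [Function.iterate_add_apply, ← h₂, ← h₁]
    rfl
  | @pop k p s s' t _ ih =>
    intro e exit hM v o
    obtain ⟨u, hu, o', h⟩ := ih (fun l => e (.popBody _ l)) exit (fun l => by rw [hM, code]) v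
      (s.2 k).head?
    refine ⟨u + 1, by omega, o', ?_⟩
    rw [Function.iterate_add_apply, ← h]
    simp [flip, hM, code, entry, ← update_inr]
    rfl
  | @loop_nil k p s hk =>
    intro e exit hM v o
    refine ⟨1, le_rfl, none, ?_⟩
    have hk' : s.stacks (.inr k) = [] := hk
    have hu : Function.update s.stacks (.inr k) [] = s.stacks := by
      rw [← hk', Function.update_eq_self]
    simp [flip, hM, code, entry, hk', hu]
  | @loop_cons k p s s₁ s₂ b l t₁ t₂ hk _ _ ih₁ ih₂ =>
    intro e exit hM v o
    have hk' : s.stacks (.inr k) = b :: l := hk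
    obtain ⟨u₁, hu₁, o₁, h₁⟩ := ih₁ (fun l => e (.loopBody b l)) (e .loop)
      (fun l => by rw [hM, code]) v (some b)
    obtain ⟨u₂, hu₂, o₂, h₂⟩ := ih₂ e exit hM v o₁
    refine ⟨u₂ + (u₁ + 1), by omega, o₂, ?_⟩
    rw [Function.iterate_add_apply, ← h₂]
    congr 1
    change _ = some (TM2.Cfg.mk (some (e .loop)) (v, o₁) s₁.stacks)
    rw [← h₁, Function.iterate_add_apply]
    simp [flip, hM, code, entry, hk', update_inr]
  | mono _ hle ih =>
    intro e exit hM v o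
    obtain ⟨u, hu, h⟩ := ih e exit hM v o
    exact ⟨u, hu.trans hle, h⟩

end Prog

/-! ### Running a program before a machine -/

variable {tm : FinTM2} {κ : Type}

/-- The statements of `tm` as statements over more stacks, labels and internal states. -/
def liftStmt {Λ : Type} (e : tm.Λ → Λ) :
    TM2.Stmt tm.Γ tm.Λ tm.σ → TM2.Stmt (Alphabet tm κ) Λ (tm.σ × Option Bool)
  | .push k f q => .push (.inl k) (fun v => f v.1) (liftStmt e q)
  | .peek k f q => .peek (.inl k) (fun v o => (f v.1 o, v.2)) (liftStmt e q)
  | .pop k f q => .pop (.inl k) (fun v o => (f v.1 o, v.2)) (liftStmt e q)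
  | .load f q => .load (fun v => (f v.1, v.2)) (liftStmt e q)
  | .branch f q₁ q₂ => .branch (fun v => f v.1) (liftStmt e q₁) (liftStmt e q₂)
  | .goto f => .goto fun v => e (f v.1)
  | .halt => .halt

/-- Configurations of `tm` as configurations with empty further stacks. -/
def liftCfg {Λ : Type} (e : tm.Λ → Λ) (c : TM2.Cfg tm.Γ tm.Λ tm.σ) :
    TM2.Cfg (Alphabet tm κ) Λ (tm.σ × Option Bool) :=
  ⟨c.l.map e, (c.var, none), Memory.stacks (c.stk, fun _ => [])⟩

variable [DecidableEq κ]

/-- A lifted statement touches neither the further stacks nor the second component of the state, so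
these stay empty and `none`. -/
theorem stepAux_liftStmt {Λ : Type} (e : tm.Λ → Λ) (q : TM2.Stmt tm.Γ tm.Λ tm.σ) (v : tm.σ)
    (S : ∀ k, List (tm.Γ k)) :
    TM2.stepAux (liftStmt (κ := κ) e q) (v, none) (Memory.stacks (S, fun _ => [])) =
      liftCfg e (TM2.stepAux q v S) := by
  induction q generalizing v S with
  | push k f q ih =>
    simp only [liftStmt, TM2.stepAux, Prog.update_inl]
    exact ih _ _
  | peek k f q ih => exact ih _ _
  | pop k f q ih =>
    simp only [liftStmt, TM2.stepAux, Prog.update_inl]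
    exact ih _ _
  | load f q ih => exact ih _ _
  | branch f q₁ q₂ ih₁ ih₂ =>
    simp only [liftStmt, TM2.stepAux]
    cases f v
    · exact ih₂ _ _
    · exact ih₁ _ _
  | goto f => rfl
  | halt => rfl

theorem step_liftCfg {Λ : Type} (e : tm.Λ → Λ)
    {M : Λ → TM2.Stmt (Alphabet tm κ) Λ (tm.σ × Option Bool)}
    (hM : ∀ l, M (e l) = liftStmt e (tm.m l)) (c : TM2.Cfg tm.Γ tm.Λ tm.σ) :
    TM2.step M (liftCfg e c) = (TM2.step tm.m c).map (liftCfg e) := by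
  obtain ⟨_ | l, v, S⟩ := c
  · rfl
  · simp only [liftCfg, Option.map_some, TM2.step, hM, stepAux_liftStmt]

theorem iterate_step_liftCfg {Λ : Type} (e : tm.Λ → Λ)
    {M : Λ → TM2.Stmt (Alphabet tm κ) Λ (tm.σ × Option Bool)}
    (hM : ∀ l, M (e l) = liftStmt e (tm.m l)) (t : ℕ) (c : Option (TM2.Cfg tm.Γ tm.Λ tm.σ)) :
    (flip bind (TM2.step M))^[t] (c.map (liftCfg e)) =
      ((flip bind (TM2.step tm.m))^[t] c).map (liftCfg e) := by
  induction t generalizing c with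
  | zero => rfl
  | succ t ih =>
    rw [Function.iterate_succ_apply, Function.iterate_succ_apply, ← ih]
    congr 1
    cases c with
    | none => rfl
    | some c => exact step_liftCfg e hM c

/-- The machine that executes the program `p`, and then halts if the stack `h` is nonempty, and
runs `tm` otherwise. -/
noncomputable abbrev machine [Fintype κ] (p : Prog tm κ) (w h : κ) : FinTM2 :=
  letI := tm.kFin
  letI := tm.ΛFin
  letI := tm.σFin
  letI := Fintype.ofFinite p.Pos
  { K := tm.K ⊕ κ
    k₀ := .inr w
    k₁ := .inl tm.k₁
    Γ := Alphabet tm κ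
    Λ := p.Pos ⊕ Option tm.Λ
    main := .inl p.entry
    σ := tm.σ × Option Bool
    initialState := (tm.initialState, none)
    Γk₀Fin := inferInstanceAs (Fintype Bool)
    m := fun
      | .inl l => Prog.code .inl (.inr none) l
      -- Popping removes the flag, and the state is reset to `none` in both branches: the
      -- configuration must be a halting configuration exactly, or the lift of an initial
      -- configuration of `tm`.
      | .inr none => .pop (.inr h) (fun v o => (v.1, o))
          (.branch (fun v => v.2.isSome) (.load (fun v => (v.1, none)) .halt)
            (.load (fun v => (v.1, none)) (.goto fun _ => .inr (some tm.main))))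
      | .inr (some l) => liftStmt (fun l => .inr (some l)) (tm.m l) }

theorem initList_eq (tm : FinTM2) (l : List (tm.Γ tm.k₀)) :
    initList tm l = ⟨some tm.main, tm.initialState, Function.update (fun _ => []) tm.k₀ l⟩ := by
  unfold initList
  congr 1
  funext k
  rcases eq_or_ne k tm.k₀ with rfl | h
  · simp
  · simp [h]

theorem haltList_eq (tm : FinTM2) (l : List (tm.Γ tm.k₁)) :
    haltList tm l = ⟨none, tm.initialState, Function.update (fun _ => []) tm.k₁ l⟩ := by
  unfold haltList
  congr 1
  funext k
  rcases eq_or_ne k tm.k₁ with rfl | h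
  · simp
  · simp [h]

theorem stacks_input [Fintype κ] (p : Prog tm κ) (w h : κ) (l : List Bool) :
    initList (machine p w h) l = ⟨some (.inl p.entry), (tm.initialState, none),
      Memory.stacks (tm := tm) (fun _ => [], Function.update (fun _ => []) w l)⟩ := by
  refine (initList_eq (machine p w h) l).trans (congrArg (TM2.Cfg.mk _ _) ?_)
  refine Eq.trans ?_ (Prog.update_inr (fun _ => [], fun _ => []) w l)
  funext k
  rcases k with k | k <;> rfl

theorem haltList_machine [Fintype κ] (p : Prog tm κ) (w h : κ) (l : List (tm.Γ tm.k₁)) :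
    haltList (machine p w h) l = liftCfg (fun l => .inr (some l)) (haltList tm l) := by
  rw [haltList_eq tm]
  refine (haltList_eq (machine p w h) l).trans (congrArg (TM2.Cfg.mk _ _) ?_)
  refine Eq.trans ?_ (Prog.update_inl (fun _ => [], fun _ => []) tm.k₁ l)
  funext k
  rcases k with k | k <;> rfl

/-- If the program leaves an output and sets the halting flag, this output is the output of the
machine. -/
theorem outputs_of_halts [Fintype κ] {p : Prog tm κ} {w h : κ} {l : List Bool}
    {out : List (tm.Γ tm.k₁)} {t : ℕ}
    (hp : p.Runs (fun _ => [], Function.update (fun _ => []) w l)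
      (Function.update (fun _ => []) tm.k₁ out, Function.update (fun _ => []) h [true]) t) :
    Nonempty (TM2OutputsInTime (machine p w h) l (some out) (t + 1)) := by
  obtain ⟨u, hu, o, hs⟩ := hp.steps (M := (machine p w h).m) .inl (.inr none) (fun _ => rfl)
    tm.initialState none
  -- The program takes `u` steps, and the test of the flag takes one more.
  refine ⟨⟨⟨1 + u, ?_⟩, (by omega : 1 + u ≤ t + 1)⟩⟩
  rw [Function.iterate_add_apply, stacks_input]
  refine (congrArg _ hs).trans ?_
  rw [Option.map_some, haltList_machine, haltList_eq]
  change some (TM2.stepAux ((machine p w h).m (.inr none)) _ _) = _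
  simp only [machine, TM2.stepAux, Prog.update_inr]
  simp [Memory.stacks, liftCfg]
  rfl

/-- If the program leaves an input for `tm`, the output of `tm` is the output of the machine. -/
theorem outputs_of_runs [Fintype κ] {p : Prog tm κ} {w h : κ} {l : List Bool}
    {inp : List (tm.Γ tm.k₀)} {out : List (tm.Γ tm.k₁)} {t t' : ℕ}
    (hp : p.Runs (fun _ => [], Function.update (fun _ => []) w l)
      (Function.update (fun _ => []) tm.k₀ inp, fun _ => []) t)
    (ht : TM2OutputsInTime tm inp (some out) t') :
    Nonempty (TM2OutputsInTime (machine p w h) l (some out) (t + t' + 1)) := by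
  obtain ⟨u, hu, o, hs⟩ := hp.steps (M := (machine p w h).m) .inl (.inr none) (fun _ => rfl)
    tm.initialState none
  obtain ⟨⟨u', hs'⟩, hu'⟩ := ht
  refine ⟨⟨⟨u' + (1 + u), ?_⟩, (by dsimp only at hu'; omega : u' + (1 + u) ≤ t + t' + 1)⟩⟩
  rw [Function.iterate_add_apply, Function.iterate_add_apply, stacks_input]
  refine (congrArg (fun c => _^[u'] (_^[1] c)) hs).trans ?_
  have := iterate_step_liftCfg (κ := κ) (M := (machine p w h).m) (fun l => .inr (some l))
    (fun _ => rfl) u' (some (initList tm inp))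
  refine Eq.trans ?_ (this.trans ((congrArg _ hs').trans ?_))
  · refine congrArg _ ?_
    rw [initList_eq]
    change some (TM2.stepAux ((machine p w h).m (.inr none)) _ _) = _
    simp only [machine, TM2.stepAux, Prog.update_inr]
    simp [Memory.stacks, liftCfg]
  · simp only [Option.map_some, haltList_machine]
    rfl

end StackProgram

/-! ### The program that extracts input and random bits from a truth table -/

namespace StackProgram

open Turing

/-- The stacks of bits: `w` holds the input, `v` and `u` hold parts of it, and the others are
counters in unary. -/
inductive Reg where
  | w | v | u | c | e | d | m | q | g | f | b | h
  deriving DecidableEq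

instance : Fintype Reg :=
  Fintype.ofList [.w, .v, .u, .c, .e, .d, .m, .q, .g, .f, .b, .h] fun k => by cases k <;> simp

/-- The contents of the stacks of bits, with unary counters as numbers. -/
structure Store where
  w : List Bool := []
  v : List Bool := []
  u : List Bool := []
  c : ℕ := 0
  e : ℕ := 0
  d : ℕ := 0
  m : ℕ := 0
  q : ℕ := 0
  g : ℕ := 0
  f : ℕ := 0
  b : ℕ := 0
  h : ℕ := 0

/-- The stack contents that a store stands for. -/
def Store.bits (s : Store) : Reg → List Bool
  | .w => s.w
  | .v => s.v
  | .u => s.u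
  | .c => List.replicate s.c true
  | .e => List.replicate s.e true
  | .d => List.replicate s.d true
  | .m => List.replicate s.m true
  | .q => List.replicate s.q true
  | .g => List.replicate s.g true
  | .f => List.replicate s.f true
  | .b => List.replicate s.b true
  | .h => List.replicate s.h true

variable {tm : FinTM2}

theorem Prog.Runs.pop_none {A : ∀ k, List (tm.Γ k)} {R : Reg → List Bool} {k : Reg}
    {p : Option Bool → Prog tm Reg} {s' : Memory tm Reg} {t : ℕ}
    (hp : (p none).Runs (A, R) s' t) (h : R k = []) : (Prog.pop k p).Runs (A, R) s' (t + 1) := by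
  refine .pop ?_
  have hu : Function.update R k (R k).tail = R := by
    rw [show (R k).tail = R k by simp [h], Function.update_eq_self]
  rw [hu]
  simpa [h] using hp

theorem Prog.Runs.pop_some {A : ∀ k, List (tm.Γ k)} {R R₁ : Reg → List Bool} {k : Reg} {x : Bool}
    {p : Option Bool → Prog tm Reg} {s' : Memory tm Reg} {t : ℕ}
    (hp : (p (some x)).Runs (A, R₁) s' t) (h : R = Function.update R₁ k (x :: R₁ k)) :
    (Prog.pop k p).Runs (A, R) s' (t + 1) := by
  refine .pop ?_
  simpa [h] using hp

/-- The program takes one store to another within `t` steps, and does not touch the stacks of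
`tm`. -/
def Exec (p : Prog tm Reg) (s s' : Store) (t : ℕ) : Prop :=
  ∀ A, p.Runs (A, s.bits) (A, s'.bits) t

namespace Exec

variable {s s₁ s' : Store} {t t₁ t₂ : ℕ} {k : Reg} {x : Bool}

theorem mono {p : Prog tm Reg} (h : Exec p s s' t₁) (ht : t₁ ≤ t₂) : Exec p s s' t₂ :=
  fun A => (h A).mono ht

theorem skip : Exec (.skip : Prog tm Reg) s s 1 := fun _ => .skip _

/-- For explicit stores, the two families of stacks agree definitionally at each register, which the
default argument exploits. -/
theorem put (k : Reg) (x : Bool)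
    (h : Function.update s.bits k (x :: s.bits k) = s'.bits := by funext k; cases k <;> rfl) :
    Exec (.put k x : Prog tm Reg) s s' 1 := fun A => h ▸ .put k x (A, s.bits)

theorem seq {p q : Prog tm Reg} (hp : Exec p s s₁ t₁) (hq : Exec q s₁ s' t₂) :
    Exec (p.seq q) s s' (t₁ + t₂) := fun A => (hp A).seq (hq A)

theorem pop_none {p : Option Bool → Prog tm Reg} (hp : Exec (p none) s s' t)
    (h : s.bits k = [] := by rfl) : Exec (.pop k p) s s' (t + 1) := fun A => (hp A).pop_none h

theorem pop_some (x : Bool) {p : Option Bool → Prog tm Reg} (hp : Exec (p (some x)) s₁ s' t)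
    (h : s.bits = Function.update s₁.bits k (x :: s₁.bits k) := by funext k; cases k <;> rfl) :
    Exec (.pop k p) s s' (t + 1) := fun A => (hp A).pop_some h

theorem loop_nil {p : Bool → Prog tm Reg} (h : s.bits k = [] := by rfl) :
    Exec (.loop k p) s s 1 := fun _ => .loop_nil h

theorem loop_cons (x : Bool) {p : Bool → Prog tm Reg} {s₂ : Store} (hp : Exec (p x) s₁ s₂ t₁)
    (hl : Exec (.loop k p) s₂ s' t₂)
    (h : s.bits = Function.update s₁.bits k (x :: s₁.bits k) := by funext k; cases k <;> rfl) :
    Exec (.loop k p) s s' (t₁ + t₂ + 1) := fun A => by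
  refine .loop_cons (b := x) (l := s₁.bits k) (by simp [h]) ?_ (hl A)
  simpa [h] using hp A

end Exec

/-! #### Moving and clearing -/

/-- Move the contents of one stack to another one, in reverse order. -/
def move (k k' : Reg) : Prog tm Reg := .loop k fun x => .put k' x

theorem runs_move {k k' : Reg} (hk : k ≠ k') (A : ∀ k, List (tm.Γ k)) (l : List Bool)
    (R : Reg → List Bool) (hl : R k = l) :
    (move k k').Runs (A, R)
      (A, Function.update (Function.update R k []) k' (l.reverse ++ R k')) (2 * l.length + 1) := by
  induction l generalizing R with
  | nil =>
    have : Function.update (Function.update R k []) k' ([].reverse ++ R k') = R := by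
      rw [show Function.update R k [] = R by rw [← hl, Function.update_eq_self]]
      simp
    rw [this]
    exact .loop_nil hl
  | cons x l ih =>
    have := Prog.Runs.loop_cons (s := (A, R)) hl (.put k' x _)
      (ih (Function.update (Function.update R k l) k' _) (by simp [Function.update_of_ne hk]))
    refine (cast ?_ this : Prog.Runs _ _ _ _).mono (t := 1 + (2 * l.length + 1) + 1)
      (by simp; omega)
    · congr 2
      funext j
      by_cases h₁ : j = k'
      · subst h₁; simp [Function.update_of_ne hk.symm]
      · by_cases h₂ : j = k
        · subst h₂; simp [h₁]
        · simp [h₁, h₂]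

theorem Exec.move {k k' : Reg} (hk : k ≠ k') {s s' : Store} {t : ℕ}
    (ht : 2 * (s.bits k).length + 1 ≤ t)
    (h : Function.update (Function.update s.bits k []) k' ((s.bits k).reverse ++ s.bits k') =
      s'.bits) : Exec (move k k' : Prog tm Reg) s s' t :=
  fun A => h ▸ (runs_move hk A _ _ rfl).mono ht

/-- Empty a stack. -/
def clear (k : Reg) : Prog tm Reg := .loop k fun _ => .skip

theorem runs_clear (k : Reg) (A : ∀ k, List (tm.Γ k)) (l : List Bool)
    (R : Reg → List Bool) (hl : R k = l) :
    (clear k).Runs (A, R) (A, Function.update R k []) (2 * l.length + 1) := by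
  induction l generalizing R with
  | nil =>
    have : Function.update R k [] = R := by rw [← hl, Function.update_eq_self]
    rw [this]
    exact .loop_nil hl
  | cons x l ih =>
    have := Prog.Runs.loop_cons (s := (A, R)) hl (.skip _) (ih (Function.update R k l) (by simp))
    rw [Function.update_idem] at this
    exact this.mono (by simp; omega)

theorem Exec.clear (k : Reg) {s s' : Store} {t : ℕ} (ht : 2 * (s.bits k).length + 1 ≤ t)
    (h : Function.update s.bits k [] = s'.bits := by funext k; cases k <;> rfl) :
    Exec (clear k : Prog tm Reg) s s' t :=
  fun A => h ▸ (runs_clear k A _ _ rfl).mono ht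

/-! #### Counting -/

/-- Set the counter `c` to the length of `w`. -/
def measure : Prog tm Reg :=
  .seq (.loop .w fun x => .seq (.put .v x) (.put .c true)) (move .v .w)

/-- The contents of `w` are reversed twice, via `v`, and hence restored. -/
theorem exec_measure (s : Store) (hv : s.v = []) :
    Exec (measure : Prog tm Reg) s { s with c := s.c + s.w.length } (5 * s.w.length + 2) := by
  have key : ∀ (l : List Bool) (s : Store), s.w = l →
      Exec (.loop .w fun x => .seq (.put .v x) (.put .c true) : Prog tm Reg) s
        { s with w := [], v := l.reverse ++ s.v, c := s.c + l.length } (3 * l.length + 1) := by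
    intro l
    induction l with
    | nil => rintro s hs; obtain ⟨⟩ := s; subst hs; exact .loop_nil
    | cons x l ih =>
      intro s hs
      obtain ⟨w, v, u, c, e, d, m, q, g, f, b, h⟩ := s
      subst hs
      have := Exec.loop_cons (s := ⟨x :: l, v, u, c, e, d, m, q, g, f, b, h⟩)
        (s₁ := ⟨l, v, u, c, e, d, m, q, g, f, b, h⟩) (k := .w) x
        (.seq (.put .v x (s' := ⟨l, x :: v, u, c, e, d, m, q, g, f, b, h⟩))
          (.put .c true (s' := ⟨l, x :: v, u, c + 1, e, d, m, q, g, f, b, h⟩)))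
        (ih ⟨l, x :: v, u, c + 1, e, d, m, q, g, f, b, h⟩ rfl)
      refine (cast ?_ this : Exec _ _ _ _).mono (t₁ := 1 + 1 + (3 * l.length + 1) + 1) ?_
      · congr 2 <;> simp; omega
      · simp; omega
  refine .mono (.seq (key s.w s rfl) (.move (by decide) le_rfl ?_)) ?_
  · funext k
    cases k <;> simp [Store.bits, hv]
  · simp [Store.bits, hv]
    omega

/-- Halve the counter `c`, using `e`. If it is odd, increase `f`. -/
def halve : Prog tm Reg :=
  .seq (.loop .c fun _ => .pop .c fun o => o.elim (.put .f true) fun _ => .put .e true)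
    (move .e .c)

/-- Each full round removes two units, one by the loop and one by the inner pop, whence the two-step
induction. The inner pop fails only on an odd leftover. -/
theorem exec_halve (s : Store) (he : s.e = 0) :
    Exec (halve : Prog tm Reg) s { s with c := s.c / 2, f := s.f + s.c % 2 }
      (5 * s.c + 5) := by
  have key : ∀ (n : ℕ) (s : Store), s.c = n →
      Exec (.loop .c fun _ => .pop .c fun o => o.elim (.put .f true) fun _ => .put .e true :
        Prog tm Reg) s
        { s with c := 0, e := s.e + n / 2, f := s.f + n % 2 } (3 * n + 4) := by
    intro n
    induction n using Nat.twoStepInduction with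
    | zero => rintro s hs; obtain ⟨⟩ := s; subst hs; exact .mono .loop_nil (by omega)
    | one =>
      intro s hs
      obtain ⟨w, v, u, c, e, d, m, q, g, f, b, h⟩ := s
      subst hs
      refine .mono (.loop_cons (s₁ := ⟨w, v, u, 0, e, d, m, q, g, f, b, h⟩)
        (s₂ := ⟨w, v, u, 0, e, d, m, q, g, f + 1, b, h⟩) true
        (.pop_none (.put .f true)) .loop_nil) (by omega)
    | more n ih _ =>
      intro s hs
      obtain ⟨w, v, u, c, e, d, m, q, g, f, b, h⟩ := s
      subst hs
      have := Exec.loop_cons (s := ⟨w, v, u, n + 2, e, d, m, q, g, f, b, h⟩)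
        (s₁ := ⟨w, v, u, n + 1, e, d, m, q, g, f, b, h⟩) (k := .c) true
        (.pop_some (s₁ := ⟨w, v, u, n, e, d, m, q, g, f, b, h⟩) true (.put .e true))
        (ih ⟨w, v, u, n, e + 1, d, m, q, g, f, b, h⟩ rfl)
      refine (cast ?_ this : Exec _ _ _ _).mono (t₁ := 1 + 1 + (3 * n + 4) + 1) (by omega)
      congr 2 <;> simp
      omega
  refine .mono (.seq (key s.c s rfl) (.move (by decide) le_rfl ?_)) ?_
  · funext k
    cases k <;> simp [Store.bits, he]
  · simp [Store.bits, he]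
    omega

/-- Halve the counter `c`, rounding up, until it vanishes, and count the rounds in `m`. -/
def countHalvings : Prog tm Reg :=
  .loop .c fun _ => .seq halve (.put .m true)

/-- Consider `N = n + 1`. A round removes one unit and halves the rest, which replaces `N` by `⌊N /
2⌋` and adds the parity of `N` to `f`; the loop stops at `N = 1`. So there are `log N` rounds, and
no odd value occurs before the end iff `N` is a power of two. -/
theorem exec_countHalvings (n : ℕ) (s : Store) (hc : s.c = n) (he : s.e = 0) :
    ∃ r ≤ n, (r = 0 ↔ ∃ k, n + 1 = 2 ^ k) ∧
      Exec (countHalvings : Prog tm Reg) s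
        { s with c := 0, m := s.m + Nat.log 2 (n + 1), f := s.f + r } (12 * n + 1) := by
  induction n using Nat.strong_induction_on generalizing s with
  | _ n ih =>
    obtain ⟨w, v, u, c, e, d, m, q, g, f, b, h⟩ := s
    subst hc he
    rcases c with _ | c
    · exact ⟨0, le_rfl, by simpa using ⟨0, rfl⟩, .loop_nil⟩
    · obtain ⟨r, hr, hiff, hex⟩ := ih (c / 2) (by simp; omega)
        ⟨w, v, u, c / 2, 0, d, m + 1, q, g, f + c % 2, b, h⟩ rfl rfl
      refine ⟨c % 2 + r, by simp; omega, ?_, ?_⟩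
      · rw [Nat.add_eq_zero_iff, hiff]
        constructor
        · rintro ⟨h2, k, hk⟩
          exact ⟨k + 1, by simp; omega⟩
        · rintro ⟨_ | k, hk⟩
          · simp at hk
          · simp only [pow_succ] at hk
            exact ⟨by omega, k, by omega⟩
      · have := Exec.loop_cons (s := ⟨w, v, u, c + 1, 0, d, m, q, g, f, b, h⟩)
          (s₁ := ⟨w, v, u, c, 0, d, m, q, g, f, b, h⟩) (k := .c) true
          (.seq (exec_halve _ rfl) (.put .m true)) hex
        refine (cast ?_ this : Exec _ _ _ _).mono (t₁ := 5 * c + 5 + 1 + (12 * (c / 2) + 1) + 1)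
          (by simp; omega)
        have hlog : Nat.log 2 (c + 1 + 1) = Nat.log 2 (c / 2 + 1) + 1 := by
          rw [Nat.log_of_one_lt_of_le (by omega) (by omega)]
          congr 2
          omega
        congr 2 <;> simp <;> omega

/-- Double the counter `d`, using `e`. -/
def double : Prog tm Reg :=
  .seq (.loop .d fun _ => .seq (.put .e true) (.put .e true)) (move .e .d)

theorem exec_double (s : Store) (he : s.e = 0) :
    Exec (double : Prog tm Reg) s { s with d := 2 * s.d } (7 * s.d + 2) := by
  have key : ∀ (n : ℕ) (s : Store), s.d = n →
      Exec (.loop .d fun _ => .seq (.put .e true) (.put .e true) : Prog tm Reg) s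
        { s with d := 0, e := s.e + 2 * n } (3 * n + 1) := by
    intro n
    induction n with
    | zero => rintro s hs; obtain ⟨⟩ := s; subst hs; exact .loop_nil
    | succ n ih =>
      intro s hs
      obtain ⟨w, v, u, c, e, d, m, q, g, f, b, h⟩ := s
      subst hs
      have := Exec.loop_cons (s := ⟨w, v, u, c, e, n + 1, m, q, g, f, b, h⟩)
        (s₁ := ⟨w, v, u, c, e, n, m, q, g, f, b, h⟩) (k := .d) true
        (.seq (.put .e true (s' := ⟨w, v, u, c, e + 1, n, m, q, g, f, b, h⟩)) (.put .e true))
        (ih ⟨w, v, u, c, e + 2, n, m, q, g, f, b, h⟩ rfl)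
      refine (cast ?_ this : Exec _ _ _ _).mono (t₁ := 1 + 1 + (3 * n + 1) + 1) (by omega)
      congr 2; simp; omega
  refine .mono (.seq (key s.d s rfl) (.move (by decide) le_rfl ?_)) ?_
  · funext k
    cases k <;> simp [Store.bits, he]
  · simp [Store.bits, he]
    omega

/-- Decrease the counter `m` by `j` and execute the program `p`, if this is possible. -/
def decrease (p : Prog tm Reg) : ℕ → Prog tm Reg
  | 0 => p
  | j + 1 => .pop .m fun o => o.elim .skip fun _ => decrease p j

theorem exec_decrease_of_le {p : Prog tm Reg} {j : ℕ} {s s' : Store} {t : ℕ} (hj : j ≤ s.m)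
    (hp : Exec p { s with m := s.m - j } s' t) : Exec (decrease p j) s s' (t + j) := by
  induction j generalizing s with
  | zero => exact hp
  | succ j ih =>
    obtain ⟨w, v, u, c, e, d, m, q, g, f, b, h⟩ := s
    obtain ⟨m, rfl⟩ : ∃ m', m = m' + 1 := ⟨m - 1, by simp at hj; omega⟩
    refine .pop_some (s₁ := ⟨w, v, u, c, e, d, m, q, g, f, b, h⟩) true (ih ?_ ?_)
    · simpa using hj
    · simpa using hp

theorem exec_decrease_of_lt {p : Prog tm Reg} {j : ℕ} {s : Store} (hj : s.m < j) :
    Exec (decrease p j) s { s with m := 0 } (j + 1) := by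
  induction j generalizing s with
  | zero => simp at hj
  | succ j ih =>
    obtain ⟨w, v, u, c, e, d, m, q, g, f, b, h⟩ := s
    rcases m with _ | m
    · exact .mono (.pop_none .skip) (by omega)
    · exact .pop_some (s₁ := ⟨w, v, u, c, e, d, m, q, g, f, b, h⟩) true (ih (by simpa using hj))

/-- Double the counter `d` as often as `K` can be subtracted from `m`. -/
def power (K : ℕ) : Prog tm Reg := .loop .m fun _ => decrease double (K - 1)

/-- The loop removes one unit of `m` and `decrease` the other `K - 1`; an incomplete last round just
empties `m`. The bound `D` holds for `d` throughout, so it bounds the cost of every doubling. -/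
theorem exec_power {K : ℕ} (hK : 0 < K) {D : ℕ} (n : ℕ) (s : Store) (hm : s.m = n) (he : s.e = 0)
    (hD : s.d * 2 ^ (n / K) ≤ D) :
    Exec (power K : Prog tm Reg) s { s with m := 0, d := s.d * 2 ^ (n / K) }
      (n * (7 * D + K + 4) + 1) := by
  induction n using Nat.strong_induction_on generalizing s with
  | _ n ih =>
    obtain ⟨w, v, u, c, e, d, m, q, g, f, b, h⟩ := s
    subst hm he
    rcases m with _ | m
    · simp only [Nat.zero_div, pow_zero, mul_one]
      exact .mono .loop_nil (by omega)
    · by_cases hle : K - 1 ≤ m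
      · have hdiv : (m + 1) / K = (m - (K - 1)) / K + 1 := by
          rw [Nat.div_eq_sub_div hK (by omega), show m + 1 - K = m - (K - 1) by omega]
        have hd : d * 2 ^ ((m + 1) / K) = 2 * d * 2 ^ ((m - (K - 1)) / K) := by
          rw [hdiv, pow_succ]; ring
        have := ih (m - (K - 1)) (by simp only; omega)
          ⟨w, v, u, c, 0, 2 * d, m - (K - 1), q, g, f, b, h⟩ rfl rfl (by simpa [← hd] using hD)
        have := Exec.loop_cons (s := ⟨w, v, u, c, 0, d, m + 1, q, g, f, b, h⟩)
          (s₁ := ⟨w, v, u, c, 0, d, m, q, g, f, b, h⟩) (k := .m) true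
          (exec_decrease_of_le hle (exec_double _ rfl)) this
        simp only [hd] at hD ⊢
        refine this.mono ?_
        have h1 : d ≤ D := le_trans (by nlinarith [Nat.one_le_two_pow (n := (m - (K - 1)) / K)]) hD
        have h2 : (m - (K - 1)) * (7 * D + K + 4) ≤ m * (7 * D + K + 4) :=
          Nat.mul_le_mul_right _ (Nat.sub_le _ _)
        rw [Nat.succ_mul m]
        dsimp only
        omega
      · have hdiv : (m + 1) / K = 0 := Nat.div_eq_of_lt (by omega)
        simp only [hdiv, pow_zero, mul_one] at hD ⊢
        have := Exec.loop_cons (tm := tm) (s := ⟨w, v, u, c, 0, d, m + 1, q, g, f, b, h⟩)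
          (s₁ := ⟨w, v, u, c, 0, d, m, q, g, f, b, h⟩) (k := .m)
          (p := fun _ => decrease double (K - 1)) true
          (exec_decrease_of_lt (not_le.1 hle)) .loop_nil
        refine this.mono ?_
        rw [Nat.succ_mul m]
        have := Nat.zero_le (m * (7 * D + K + 4))
        omega

/-! #### Evaluating polynomials -/

/-- Add the counter `d` to the counter `g`, using `e`. -/
def addTo : Prog tm Reg :=
  .seq (.loop .d fun _ => .seq (.put .e true) (.put .g true)) (move .e .d)

theorem exec_addTo (s : Store) (he : s.e = 0) :
    Exec (addTo : Prog tm Reg) s { s with g := s.g + s.d } (5 * s.d + 2) := by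
  have key : ∀ (n : ℕ) (s : Store), s.d = n →
      Exec (.loop .d fun _ => .seq (.put .e true) (.put .g true) : Prog tm Reg) s
        { s with d := 0, e := s.e + n, g := s.g + n } (3 * n + 1) := by
    intro n
    induction n with
    | zero => rintro s hs; obtain ⟨⟩ := s; subst hs; exact .loop_nil
    | succ n ih =>
      intro s hs
      obtain ⟨w, v, u, c, e, d, m, q, g, f, b, h⟩ := s
      subst hs
      have := Exec.loop_cons (s := ⟨w, v, u, c, e, n + 1, m, q, g, f, b, h⟩)
        (s₁ := ⟨w, v, u, c, e, n, m, q, g, f, b, h⟩) (k := .d) true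
        (.seq (.put .e true (s' := ⟨w, v, u, c, e + 1, n, m, q, g, f, b, h⟩)) (.put .g true))
        (ih ⟨w, v, u, c, e + 1, n, m, q, g + 1, f, b, h⟩ rfl)
      refine (cast ?_ this : Exec _ _ _ _).mono (t₁ := 1 + 1 + (3 * n + 1) + 1) (by omega)
      congr 2 <;> simp <;> omega
  refine .mono (.seq (key s.d s rfl) (.move (by decide) le_rfl ?_)) ?_
  · funext k
    cases k <;> simp [Store.bits, he]
  · simp [Store.bits, he]
    omega

/-- Multiply the counter `q` by the counter `d`, using `e` and `g`. -/
def multiply : Prog tm Reg := .seq (.loop .q fun _ => addTo) (move .g .q)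

theorem exec_multiply (s : Store) (he : s.e = 0) (hg : s.g = 0) :
    Exec (multiply : Prog tm Reg) s { s with q := s.q * s.d }
      (s.q * (5 * s.d + 3) + 2 * (s.q * s.d) + 2) := by
  have key : ∀ (n : ℕ) (s : Store), s.q = n → s.e = 0 →
      Exec (.loop .q fun _ => addTo : Prog tm Reg) s
        { s with q := 0, g := s.g + n * s.d } (n * (5 * s.d + 3) + 1) := by
    intro n
    induction n with
    | zero =>
      rintro s hs -
      obtain ⟨⟩ := s
      subst hs
      simpa only [zero_mul, zero_add, add_zero] using Exec.loop_nil
    | succ n ih =>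
      intro s hs he
      obtain ⟨w, v, u, c, e, d, m, q, g, f, b, h⟩ := s
      subst hs he
      have := Exec.loop_cons (s := ⟨w, v, u, c, 0, d, m, n + 1, g, f, b, h⟩)
        (s₁ := ⟨w, v, u, c, 0, d, m, n, g, f, b, h⟩) (k := .q) true
        (exec_addTo _ rfl) (ih ⟨w, v, u, c, 0, d, m, n, g + d, f, b, h⟩ rfl rfl)
      refine (cast ?_ this : Exec _ _ _ _).mono
        (t₁ := 5 * d + 2 + (n * (5 * d + 3) + 1) + 1) (by simp only [Nat.succ_mul]; omega)
      congr 2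
      simp only [Nat.succ_mul]
      omega
  refine .mono (.seq (key s.q s rfl he) (.move (by decide) le_rfl ?_)) ?_
  · funext k
    cases k <;> simp [Store.bits, hg]
  · simp [Store.bits, hg]
    omega

/-- Add a constant to the counter `q`. -/
def addConst : ℕ → Prog tm Reg
  | 0 => .skip
  | n + 1 => .seq (addConst n) (.put .q true)

theorem exec_addConst (n : ℕ) (s : Store) :
    Exec (addConst n : Prog tm Reg) s { s with q := s.q + n } (n + 1) := by
  induction n with
  | zero => exact .skip
  | succ n ih => exact .seq ih (.put .q true)

/-- A program that evaluates a polynomial at the counter `d`. -/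
theorem exists_exec_eval (tm : FinTM2) (p : Polynomial ℕ) :
    ∃ (P : Prog tm Reg) (T : Polynomial ℕ), ∀ s : Store, s.q = 0 → s.e = 0 → s.g = 0 →
      Exec P s { s with q := p.eval s.d } (T.eval s.d) := by
  -- By Horner's scheme, one accumulator `q` suffices: it is multiplied by `d` or increased by a
  -- constant.
  induction p using Polynomial.recOnHorner with
  | M0 =>
    refine ⟨.skip, 1, fun s hq _ _ => ?_⟩
    obtain ⟨⟩ := s
    subst hq
    simpa only [Polynomial.eval_zero, Polynomial.eval_one] using Exec.skip
  | MC p a _ _ ih =>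
    obtain ⟨P, T, h⟩ := ih
    refine ⟨P.seq (addConst a), T + .C (a + 1), fun s hq he hg => ?_⟩
    simp only [Polynomial.eval_add, Polynomial.eval_C]
    exact .seq (h s hq he hg) (exec_addConst a _)
  | MX p _ ih =>
    obtain ⟨P, T, h⟩ := ih
    refine ⟨P.seq multiply, T + (p * (5 * .X + 3) + 2 * (p * .X) + 2), fun s hq he hg => ?_⟩
    simp only [Polynomial.eval_add, Polynomial.eval_mul, Polynomial.eval_X, Polynomial.eval_ofNat]
    exact .seq (h s hq he hg) (exec_multiply _ he hg)

end StackProgram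

/-- Coefficients in `ℕ` are nonnegative. This allows time bounds to be evaluated at larger
arguments. -/
theorem Polynomial.eval_le_eval_of_le (p : Polynomial ℕ) {a b : ℕ} (h : a ≤ b) :
    p.eval a ≤ p.eval b := by
  rw [Polynomial.eval_eq_sum_range, Polynomial.eval_eq_sum_range]
  gcongr

namespace StackProgram

open Turing

variable {tm : FinTM2}

/-! ### Splitting a word into input, random bits and rest -/

/-- Move bits from `w` to `k'`, as many as the counter `k` says, and count the missing bits in
`b`. -/
def extract (k k' : Reg) : Prog tm Reg :=
  .loop k fun _ => .pop .w fun o => o.elim (.put .b true) fun x => .put k' x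

theorem exec_extract_d (n : ℕ) (s : Store) (hn : s.d = n) :
    Exec (extract .d .v : Prog tm Reg) s
      { s with d := 0, w := s.w.drop n, v := (s.w.take n).reverse ++ s.v,
               b := s.b + (n - s.w.length) } (3 * n + 1) := by
  induction n generalizing s with
  | zero => obtain ⟨⟩ := s; subst hn; simpa [extract] using Exec.loop_nil
  | succ n ih =>
    obtain ⟨w, v, u, c, e, d, m, q, g, f, b, h⟩ := s
    subst hn
    rcases w with _ | ⟨x, w⟩
    · have := Exec.loop_cons (s := ⟨[], v, u, c, e, n + 1, m, q, g, f, b, h⟩)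
        (s₁ := ⟨[], v, u, c, e, n, m, q, g, f, b, h⟩) (k := .d) true
        (.pop_none (.put .b true)) (ih ⟨[], v, u, c, e, n, m, q, g, f, b + 1, h⟩ rfl)
      refine (cast ?_ this : Exec _ _ _ _).mono (t₁ := 1 + 1 + (3 * n + 1) + 1) (by omega)
      congr 2 <;> simp
      omega
    · have := Exec.loop_cons (s := ⟨x :: w, v, u, c, e, n + 1, m, q, g, f, b, h⟩)
        (s₁ := ⟨x :: w, v, u, c, e, n, m, q, g, f, b, h⟩) (k := .d) true
        (.pop_some (s₁ := ⟨w, v, u, c, e, n, m, q, g, f, b, h⟩) x (.put .v x))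
        (ih ⟨w, x :: v, u, c, e, n, m, q, g, f, b, h⟩ rfl)
      refine (cast ?_ this : Exec _ _ _ _).mono (t₁ := 1 + 1 + (3 * n + 1) + 1) (by omega)
      congr 2 <;> simp

theorem exec_extract_q (n : ℕ) (s : Store) (hn : s.q = n) :
    Exec (extract .q .u : Prog tm Reg) s
      { s with q := 0, w := s.w.drop n, u := (s.w.take n).reverse ++ s.u,
               b := s.b + (n - s.w.length) } (3 * n + 1) := by
  induction n generalizing s with
  | zero => obtain ⟨⟩ := s; subst hn; simpa [extract] using Exec.loop_nil
  | succ n ih =>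
    obtain ⟨w, v, u, c, e, d, m, q, g, f, b, h⟩ := s
    subst hn
    rcases w with _ | ⟨x, w⟩
    · have := Exec.loop_cons (s := ⟨[], v, u, c, e, d, m, n + 1, g, f, b, h⟩)
        (s₁ := ⟨[], v, u, c, e, d, m, n, g, f, b, h⟩) (k := .q) true
        (.pop_none (.put .b true)) (ih ⟨[], v, u, c, e, d, m, n, g, f, b + 1, h⟩ rfl)
      refine (cast ?_ this : Exec _ _ _ _).mono (t₁ := 1 + 1 + (3 * n + 1) + 1) (by omega)
      congr 2 <;> simp
      omega
    · have := Exec.loop_cons (s := ⟨x :: w, v, u, c, e, d, m, n + 1, g, f, b, h⟩)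
        (s₁ := ⟨x :: w, v, u, c, e, d, m, n, g, f, b, h⟩) (k := .q) true
        (.pop_some (s₁ := ⟨w, v, u, c, e, d, m, n, g, f, b, h⟩) x (.put .u x))
        (ih ⟨w, v, x :: u, c, e, d, m, n, g, f, b, h⟩ rfl)
      refine (cast ?_ this : Exec _ _ _ _).mono (t₁ := 1 + 1 + (3 * n + 1) + 1) (by omega)
      congr 2 <;> simp

/-- Extract `2 ^ (log |w| / K)` bits of `w` to `v`, and the number of bits that the program `P`
computes to `u`. -/
def parse (K : ℕ) (P : Prog tm Reg) : Prog tm Reg :=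
  measure.seq <| (Prog.pop .c fun o => o.elim (.put .f true) fun _ => .skip).seq <|
    (Prog.put .d true).seq <| countHalvings.seq <| (power K).seq <| P.seq <|
    (extract .d .v).seq (extract .q .u)

/-- Two counters carry the verdicts: `f` vanishes iff the length is a power of two, and `b` vanishes
iff there are enough bits. The blocks in `v` and `u` come out reversed, which `send` undoes. -/
theorem exec_parse {K : ℕ} (hK : 0 < K) {p T : Polynomial ℕ} {P : Prog tm Reg}
    (hP : ∀ s : Store, s.q = 0 → s.e = 0 → s.g = 0 →
      Exec P s { s with q := p.eval s.d } (T.eval s.d)) (w : List Bool) (X : ℕ)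
    (hX : X = 2 ^ (Nat.log 2 w.length / K)) :
    ∃ r ≤ w.length + 1, (r = 0 ↔ ∃ k, w.length = 2 ^ k) ∧
      Exec (parse K P) { w := w }
        { w := (w.drop X).drop (p.eval X), v := (w.take X).reverse,
          u := ((w.drop X).take (p.eval X)).reverse, f := r,
          b := (X - w.length) + (p.eval X - (w.drop X).length) }
        (5 * w.length + 2 + (1 + 1 + (1 + (12 * w.length + 1 +
          (w.length * (7 * X + K + 4) + 1 + (T.eval X + (3 * X + 1 + (3 * p.eval X + 1)))))))) := by
  have tail : ∀ r, Exec (tm := tm) ((power K).seq <| P.seq <|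
      (extract .d .v).seq (extract .q .u)) { w := w, d := 1, m := Nat.log 2 w.length, f := r }
        { w := (w.drop X).drop (p.eval X), v := (w.take X).reverse,
          u := ((w.drop X).take (p.eval X)).reverse, f := r,
          b := (X - w.length) + (p.eval X - (w.drop X).length) }
      (w.length * (7 * X + K + 4) + 1 + (T.eval X + (3 * X + 1 + (3 * p.eval X + 1)))) := by
    intro r
    refine .seq (s₁ := { w := w, d := X, f := r }) ?_ ?_
    · have := exec_power (tm := tm) hK (D := X) (Nat.log 2 w.length)
        { w := w, d := 1, m := Nat.log 2 w.length, f := r } rfl rfl (by simp [hX])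
      simp only [one_mul, ← hX] at this
      refine this.mono ?_
      gcongr
      exact Nat.log_le_self _ _
    · refine .seq (hP _ rfl rfl rfl) ?_
      refine .seq (exec_extract_d X _ rfl) ?_
      have := exec_extract_q (tm := tm) (p.eval X)
        { w := w.drop X, v := (w.take X).reverse, q := p.eval X, f := r, b := X - w.length } rfl
      simpa using this
  rcases w with _ | ⟨x, w⟩
  -- The empty word is caught by the pop of `c`, since its length is not a power of two.
  · refine ⟨1, le_rfl, by simpa using fun k => (Nat.two_pow_pos k).ne, ?_⟩
    refine .seq (exec_measure _ rfl) (.seq (.pop_none (.put .f true (s' := { f := 1 }))) ?_)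
    refine .seq (.put .d true (s' := { f := 1, d := 1 })) (.seq ?_ (tail 1))
    exact .mono (.loop_nil) (by simp)
  -- The pop leaves the length minus one in `c`, which is the shift that `exec_countHalvings`
  -- expects.
  · obtain ⟨r, hr, hiff, hex⟩ := exec_countHalvings (tm := tm) w.length
      { w := x :: w, d := 1, c := w.length } rfl rfl
    refine ⟨r, by simp; omega, by simpa using hiff, ?_⟩
    refine .seq (exec_measure _ rfl) (.seq (.pop_some (s₁ := { w := x :: w, c := w.length })
      true .skip ?_) ?_)
    · funext k
      cases k <;> simp [Store.bits, List.replicate_succ]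
    refine .seq (.put .d true (s' := { w := x :: w, d := 1, c := w.length })) ?_
    refine .seq (hex.mono ?_) (by simpa using tail r)
    simp

/-! #### Output -/

/-- Move the contents of a stack of bits to a stack of `tm`, in reverse order, encoding the bits
by `φ`. -/
def send (k : Reg) {k' : tm.K} (φ : Bool → tm.Γ k') : Prog tm Reg :=
  .loop k fun x => .emit k' (φ x)

theorem runs_send (k : Reg) {k' : tm.K} (φ : Bool → tm.Γ k') (A : ∀ k, List (tm.Γ k))
    (l : List Bool) (R : Reg → List Bool) (hl : R k = l) :
    (send k φ).Runs (A, R) (Function.update A k' (l.reverse.map φ ++ A k'), Function.update R k [])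
      (2 * l.length + 1) := by
  induction l generalizing A R with
  | nil =>
    have : Function.update R k [] = R := by rw [← hl, Function.update_eq_self]
    rw [this]
    simpa [send] using Prog.Runs.loop_nil (s := (A, R)) hl
  | cons x l ih =>
    have := Prog.Runs.loop_cons (s := (A, R)) (p := fun x => .emit k' (φ x)) hl (.emit k' (φ x) _)
      (ih (Function.update A k' (φ x :: A k')) (Function.update R k l) (by simp))
    refine Prog.Runs.mono (t := 1 + (2 * l.length + 1) + 1) ?_ (by simp; omega)
    simpa [send] using this

/-- Halt with a given output. -/
def answer (a : tm.Γ tm.k₁) : Prog tm Reg :=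
  (clear .f).seq <| (clear .u).seq <| (clear .v).seq <| (clear .b).seq <|
    (Prog.emit tm.k₁ a).seq (.put .h true)

/-- In a halting configuration all stacks but the output must be empty; the flag in `h` is removed
by the test that follows. -/
theorem runs_answer (a : tm.Γ tm.k₁) (v u : List Bool) (f b : ℕ) :
    (answer a).Runs (fun _ => [], Store.bits { v := v, u := u, f := f, b := b })
      (Function.update (fun _ => []) tm.k₁ [a], Function.update (fun _ => []) .h [true])
      (2 * f + 1 + (2 * u.length + 1 + (2 * v.length + 1 + (2 * b + 1 + (1 + 1))))) := by
  refine .seq (Exec.clear .f (s' := { v := v, u := u, b := b }) (by simp [Store.bits]) ?_ _) ?_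
  · funext k; cases k <;> rfl
  refine .seq (Exec.clear .u (s' := { v := v, b := b }) (by simp [Store.bits]) ?_ _) ?_
  · funext k; cases k <;> rfl
  refine .seq (Exec.clear .v (s' := { b := b }) (by simp [Store.bits]) ?_ _) ?_
  · funext k; cases k <;> rfl
  refine .seq (Exec.clear .b (s' := {}) (by simp [Store.bits]) ?_ _) ?_
  · funext k; cases k <;> rfl
  refine .seq (.emit _ _ _) ?_
  have hR : Function.update (fun _ => []) Reg.h [true] =
      Function.update (Store.bits {}) Reg.h (true :: Store.bits {} Reg.h) := by
    funext k; cases k <;> rfl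
  rw [hR]
  exact .put _ _ _

/-- Halt with output `out false` if `f` is nonempty, and else with output `out true` if `b` is
nonempty, and else move `v` and `u` to the input stack of `tm`. -/
def finish (out : Bool → tm.Γ tm.k₁) (φ ψ : Bool → tm.Γ tm.k₀) : Prog tm Reg :=
  (clear .w).seq <| .pop .f fun o => o.elim
    (.pop .b fun o => o.elim ((send .u ψ).seq (send .v φ)) fun _ => answer (out true))
    fun _ => answer (out false)

/-- The random bits in `u` are pushed before the input in `v`, because the input has to end up on
top. -/
theorem runs_finish (out : Bool → tm.Γ tm.k₁) (φ ψ : Bool → tm.Γ tm.k₀) (w v u : List Bool)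
    (f b t : ℕ)
    (ht : 2 * w.length + 2 * v.length + 2 * u.length + 2 * f + 2 * b + 9 ≤ t) :
    (0 < f → (finish out φ ψ).Runs
        (fun _ => [], Store.bits { w := w, v := v, u := u, f := f, b := b })
        (Function.update (fun _ => []) tm.k₁ [out false],
          Function.update (fun _ => []) .h [true]) t) ∧
      (f = 0 → 0 < b → (finish out φ ψ).Runs
        (fun _ => [], Store.bits { w := w, v := v, u := u, f := f, b := b })
        (Function.update (fun _ => []) tm.k₁ [out true],
          Function.update (fun _ => []) .h [true]) t) ∧
      (f = 0 → b = 0 → (finish out φ ψ).Runs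
        (fun _ => [], Store.bits { w := w, v := v, u := u, f := f, b := b })
        (Function.update (fun _ => []) tm.k₀ (v.reverse.map φ ++ u.reverse.map ψ), fun _ => [])
        t) := by
  have hw : Exec (tm := tm) (clear .w) { w := w, v := v, u := u, f := f, b := b }
      { v := v, u := u, f := f, b := b } (2 * w.length + 1) := by
    refine Exec.clear .w le_rfl ?_
    funext k; cases k <;> rfl
  refine ⟨fun hf => ?_, fun hf hb => ?_, fun hf hb => ?_⟩
  · obtain ⟨f, rfl⟩ : ∃ f', f = f' + 1 := ⟨f - 1, by omega⟩
    refine .mono (.seq (hw _) (.pop_some (x := true) (runs_answer (out false) v u f b) ?_))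
      (by omega)
    funext k; cases k <;> rfl
  · subst hf
    obtain ⟨b, rfl⟩ : ∃ b', b = b' + 1 := ⟨b - 1, by omega⟩
    refine .mono (.seq (hw _) (.pop_none (.pop_some (x := true)
      (runs_answer (out true) v u 0 b) ?_) rfl)) (by omega)
    funext k; cases k <;> rfl
  · subst hf hb
    have hs := runs_send .u ψ (fun _ => []) u (Store.bits { v := v, u := u }) rfl
    have hs' := runs_send .v φ (Function.update (fun _ => []) tm.k₀ (u.reverse.map ψ ++ [])) v
      (Function.update (Store.bits { v := v, u := u }) .u []) rfl
    have hR : Function.update (Function.update (Store.bits { v := v, u := u }) .u []) .v [] =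
        fun _ => [] := by
      funext k; cases k <;> rfl
    rw [hR, Function.update_idem, Function.update_self, List.append_nil] at hs'
    exact .mono (.seq (hw _) (.pop_none (.pop_none (.seq hs (by simpa using hs')) rfl) rfl))
      (by omega)

/-- Extraction of an input and random bits from a truth table, as a program that runs before the
machine `tm`, which gets both. -/
theorem exists_runs_parse (tm : FinTM2) {K : ℕ} (hK : 0 < K) (p : Polynomial ℕ)
    (out : Bool → tm.Γ tm.k₁) (φ ψ : Bool → tm.Γ tm.k₀) :
    ∃ (P : Prog tm Reg) (T : Polynomial ℕ), ∀ (w : List Bool) (X : ℕ),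
      X = 2 ^ (Nat.log 2 w.length / K) →
      ((¬ ∃ k, w.length = 2 ^ k) →
        P.Runs (fun _ => [], Function.update (fun _ => []) .w w)
          (Function.update (fun _ => []) tm.k₁ [out false],
            Function.update (fun _ => []) .h [true]) (T.eval w.length)) ∧
      ((∃ k, w.length = 2 ^ k) → w.length < X + p.eval X →
        P.Runs (fun _ => [], Function.update (fun _ => []) .w w)
          (Function.update (fun _ => []) tm.k₁ [out true],
            Function.update (fun _ => []) .h [true]) (T.eval w.length)) ∧
      ((∃ k, w.length = 2 ^ k) → X + p.eval X ≤ w.length →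
        P.Runs (fun _ => [], Function.update (fun _ => []) .w w)
          (Function.update (fun _ => []) tm.k₀
            ((w.take X).map φ ++ ((w.drop X).take (p.eval X)).map ψ), fun _ => [])
          (T.eval w.length)) := by
  obtain ⟨P, T, hP⟩ := exists_exec_eval tm p
  refine ⟨(parse K P).seq (finish out φ ψ),
    (5 * .X + 2 + (1 + 1 + (1 + (12 * .X + 1 + (.X * (7 * (.X + 1) + .C K + 4) + 1 +
      (T.comp (.X + 1) + (3 * (.X + 1) + 1 + (3 * p.comp (.X + 1) + 1)))))))) +
      (12 * .X + 2 * p.comp (.X + 1) + 13), ?_⟩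
  intro w X hX
  obtain ⟨r, hr, hiff, hex⟩ := exec_parse hK hP w X hX
  -- The summand `1` is needed only for the empty word, where `X = 1`.
  have hXle : X ≤ w.length + 1 := by
    rcases Nat.eq_zero_or_pos w.length with h0 | h0
    · simp [hX, h0]
    · calc X ≤ 2 ^ Nat.log 2 w.length := hX ▸ Nat.pow_le_pow_right two_pos (Nat.div_le_self _ _)
        _ ≤ w.length := Nat.pow_log_le_self 2 h0.ne'
        _ ≤ _ := Nat.le_succ _
  have hT := T.eval_le_eval_of_le hXle
  have hp := p.eval_le_eval_of_le hXle
  have hmul : w.length * (7 * X + K + 4) ≤ w.length * (7 * (w.length + 1) + K + 4) := by gcongr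
  have hex' := (hex.mono (t₂ := 5 * w.length + 2 + (1 + 1 + (1 + (12 * w.length + 1 +
    (w.length * (7 * (w.length + 1) + K + 4) + 1 + (T.eval (w.length + 1) +
      (3 * (w.length + 1) + 1 + (3 * p.eval (w.length + 1) + 1)))))))) (by omega)) fun _ => []
  have hbits : Store.bits { w := w } = Function.update (fun _ => []) .w w := by
    funext k; cases k <;> rfl
  rw [hbits] at hex'
  obtain ⟨h₁, h₂, h₃⟩ := runs_finish out φ ψ ((w.drop X).drop (p.eval X)) (w.take X).reverse
    ((w.drop X).take (p.eval X)).reverse r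
    ((X - w.length) + (p.eval X - (w.drop X).length)) (12 * w.length + 2 * p.eval (w.length + 1) + 13)
    (by simp only [List.length_drop, List.length_take, List.length_reverse]; omega)
  simp only [Polynomial.eval_add, Polynomial.eval_mul, Polynomial.eval_X, Polynomial.eval_C,
    Polynomial.eval_comp, Polynomial.eval_one, Polynomial.eval_ofNat]
  simp only [List.length_drop, List.reverse_reverse] at h₁ h₂ h₃ hex'
  refine ⟨fun hk => hex'.seq (h₁ ?_), fun hk hlt => hex'.seq (h₂ (hiff.2 hk) ?_),
    fun hk hle => hex'.seq (h₃ (hiff.2 hk) ?_)⟩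
  · rw [← hiff] at hk
    omega
  · omega
  · omega

end StackProgram

/-! ### Truth tables -/

theorem length_truthTable : ∀ (n : ℕ) (f : BoolFun n), (truthTable n f).length = 2 ^ n
  | 0, _ => rfl
  | n + 1, f => by
    rw [truthTable, List.length_append, length_truthTable n, length_truthTable n, pow_succ]
    ring

theorem truthTable_injective : ∀ n : ℕ, Function.Injective (truthTable n)
  | 0, f, g, h => by
    funext y
    rw [Subsingleton.elim y Fin.elim0]
    simpa [truthTable] using h
  | n + 1, f, g, h => by
    obtain ⟨h₀, h₁⟩ := List.append_inj h (by rw [length_truthTable, length_truthTable])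
    funext y
    have e₀ := congrFun (truthTable_injective n h₀) (Fin.tail y)
    have e₁ := congrFun (truthTable_injective n h₁) (Fin.tail y)
    rw [← Fin.cons_self_tail y]
    cases y 0
    · exact e₀
    · exact e₁

theorem exists_truthTable_eq : ∀ (n : ℕ) (l : List Bool), l.length = 2 ^ n →
    ∃ f : BoolFun n, truthTable n f = l
  | 0, l, h => by
    obtain ⟨b, rfl⟩ := List.length_eq_one_iff.1 h
    exact ⟨fun _ => b, rfl⟩
  | n + 1, l, h => by
    rw [pow_succ] at h
    obtain ⟨f, hf⟩ := exists_truthTable_eq n (l.take (2 ^ n)) (by rw [List.length_take]; omega)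
    obtain ⟨g, hg⟩ := exists_truthTable_eq n (l.drop (2 ^ n)) (by rw [List.length_drop]; omega)
    refine ⟨fun y => if y 0 then g (Fin.tail y) else f (Fin.tail y), ?_⟩
    simp only [truthTable, Fin.cons_zero, Fin.tail_cons, Bool.false_eq_true, if_false, if_true]
    rw [hf, hg, List.take_append_drop]

/-! ### Restrictions of functions and circuits -/

/-- The function with `false` plugged into the first input. -/
def BoolFun.restrict {n : ℕ} (f : BoolFun (n + 1)) : BoolFun n := fun y => f (Fin.cons false y)

/-- Plug `false` into the first input. -/
def Wire.restrict {n s : ℕ} : Wire (n + 1) s → Wire n s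
  | .const b => .const b
  | .input i => Fin.cases (.const false) .input i
  | .gate j => .gate j

/-- Restriction can identify distinct wires only in a constant, and constants may be repeated at a
gate. So restricted circuits obey `no_repeat` with all fan-ins unchanged. -/
theorem Wire.restrict_eq {n s : ℕ} {v w : Wire (n + 1) s} (h : v.restrict = w.restrict) :
    v = w ∨ ∃ b, v.restrict = .const b := by
  rcases v with b | i | j
  · exact .inr ⟨b, rfl⟩
  · induction i using Fin.cases with
    | zero => exact .inr ⟨false, rfl⟩
    | succ i =>
      rcases w with b | k | j
      · simp [Wire.restrict] at h
      · induction k using Fin.cases with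
        | zero => simp [Wire.restrict] at h
        | succ k => left; simpa [Wire.restrict] using h
      · simp [Wire.restrict] at h
  · rcases w with b | k | j'
    · simp [Wire.restrict] at h
    · induction k using Fin.cases <;> simp [Wire.restrict] at h
    · left; simpa [Wire.restrict] using h

namespace Circuit

variable {n : ℕ}

/-- The circuit with `false` plugged into the first input. -/
def restrict (C : Circuit (n + 1)) : Circuit n where
  size := C.size
  type := C.type
  args i := (C.args i).map Wire.restrict
  output := C.output.restrict
  not_fanIn i hi := by rw [List.length_map, C.not_fanIn i hi]
  no_repeat i := by
    rw [List.pairwise_map]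
    refine (C.no_repeat i).imp fun {v w} hvw h => ?_
    rcases Wire.restrict_eq h with rfl | hb
    · obtain ⟨b, rfl⟩ := hvw rfl
      exact ⟨b, rfl⟩
    · exact hb

theorem gateValue_restrict (C : Circuit (n + 1)) (x : Fin n → Bool) (i : Fin C.size) :
    C.restrict.gateValue x i = C.gateValue (Fin.cons false x) i := by
  obtain ⟨i, hi⟩ := i
  induction i using Nat.strong_induction_on with
  | _ i ih =>
    refine (gateValue.eq_def C.restrict x ⟨i, hi⟩).trans ?_
    rw [gateValue.eq_def C]
    simp only [restrict, List.map_map]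
    congr 1
    refine List.map_congr_left fun w _ => ?_
    rcases w with b | k | j
    · rfl
    · induction k using Fin.cases <;> rfl
    · exact ih j.1 j.2 _

theorem eval_restrict (C : Circuit (n + 1)) : C.restrict.eval = C.eval.restrict := by
  funext x
  have hout : C.restrict.output = C.output.restrict := rfl
  simp only [BoolFun.restrict, eval]
  rw [hout]
  rcases C.output with b | k | j
  · rfl
  · induction k using Fin.cases <;> rfl
  · exact C.gateValue_restrict x j

theorem gateDepth_restrict (C : Circuit (n + 1)) (i : Fin C.size) :
    C.restrict.gateDepth i = C.gateDepth i := by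
  obtain ⟨i, hi⟩ := i
  induction i using Nat.strong_induction_on with
  | _ i ih =>
    refine (gateDepth.eq_def C.restrict ⟨i, hi⟩).trans ?_
    rw [gateDepth.eq_def C]
    simp only [restrict, List.map_map]
    congr 2
    refine List.map_congr_left fun w _ => ?_
    rcases w with b | k | j
    · rfl
    · induction k using Fin.cases <;> rfl
    · exact ih j.1 j.2 _

theorem depth_restrict (C : Circuit (n + 1)) : C.restrict.depth = C.depth := by
  have hout : C.restrict.output = C.output.restrict := rfl
  simp only [depth]
  rw [hout]
  rcases C.output with b | k | j
  · rfl
  · induction k using Fin.cases <;> rfl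
  · exact C.gateDepth_restrict j

theorem FanInTwo.restrict {C : Circuit (n + 1)} (h : C.FanInTwo) : C.restrict.FanInTwo :=
  fun i => by
    have := h i
    rwa [← List.length_map (f := Wire.restrict)] at this

end Circuit

/-- Every function on `m` inputs has a restriction to `n ≤ m` inputs whose truth table is an
initial segment of its truth table, and which has the same circuit complexity. -/
theorem exists_restriction {n m : ℕ} (h : n ≤ m) (f : BoolFun m) :
    ∃ g : BoolFun n, truthTable n g = (truthTable m f).take (2 ^ n) ∧
      ∀ C : Circuit m, C.eval = f → ∃ C' : Circuit n, C'.eval = g ∧ C'.size = C.size ∧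
        C'.depth = C.depth ∧ (∀ S, C.HasBasis S → C'.HasBasis S) ∧
        (C.FanInTwo → C'.FanInTwo) := by
  induction m, h using Nat.le_induction with
  | base =>
    refine ⟨f, ?_, fun C hC => ⟨C, hC, rfl, rfl, fun _ => id, id⟩⟩
    rw [← length_truthTable n f, List.take_length]
  | succ m hnm ih =>
    obtain ⟨g, hg, hC⟩ := ih f.restrict
    refine ⟨g, ?_, fun C hCf => ?_⟩
    -- In lexicographic order, the inputs that begin with `false` fill the first half of the table.
    · rw [hg, truthTable, List.take_append_of_le_length]
      · rfl
      · rw [length_truthTable]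
        exact Nat.pow_le_pow_right two_pos hnm
    · obtain ⟨C', h₁, h₂, h₃, h₄, h₅⟩ := hC C.restrict (by rw [C.eval_restrict, hCf])
      exact ⟨C', h₁, h₂, h₃.trans C.depth_restrict, fun S hS => h₄ S hS, fun h => h₅ h.restrict⟩

/-- The restriction of a function with small circuits has small circuits. -/
theorem TypicalClass.exists_restriction_hasCircuit (𝒞 : TypicalClass) {K n : ℕ} (hK : 0 < K)
    (hn : 8 ≤ n) (hKn : K ≤ n) (f : BoolFun (K * n)) :
    ∃ g : BoolFun n, truthTable n g = (truthTable (K * n) f).take (2 ^ n) ∧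
      ∀ k d m, 𝒞.HasCircuit d m ((K * n) ^ k) f → 𝒞.HasCircuit (3 * d) m (n ^ (2 * k)) g := by
  obtain ⟨g, hg, hC⟩ := exists_restriction (Nat.le_mul_of_pos_left n hK) f
  refine ⟨g, hg, ?_⟩
  rintro k d m ⟨C, hcls, hsize, hCf⟩
  obtain ⟨C', h₁, h₂, h₃, h₄, h₅⟩ := hC C hCf
  -- From `K * n ≤ n ^ 2` it follows that `log (K * n) ≤ 2 * log n + 1 ≤ 3 * log n`. For `NC`, this
  -- factor is absorbed by `3 * log n ≤ (log n) ^ 3`. Both uses turn `d` into `3 * d`.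
  have hlog3 : 3 ≤ Nat.log 2 n := Nat.le_log_of_pow_le (by norm_num) hn
  have hlog : Nat.log 2 (K * n) ≤ 3 * Nat.log 2 n := by
    have : K * n < 2 ^ (2 * (Nat.log 2 n + 1)) :=
      calc K * n ≤ n * n := Nat.mul_le_mul_right n hKn
        _ = n ^ 2 := (sq n).symm
        _ < (2 ^ (Nat.log 2 n + 1)) ^ 2 :=
          Nat.pow_lt_pow_left (Nat.lt_pow_succ_log_self one_lt_two n) two_ne_zero
        _ = _ := by rw [← pow_mul, mul_comm]
    have := Nat.log_lt_of_lt_pow (by positivity) this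
    omega
  refine ⟨C', ?_, ?_, h₁⟩
  · cases 𝒞 with
    | AC0 => exact ⟨h₄ _ hcls.1, by have := hcls.2; omega⟩
    | ACC => exact ⟨h₄ _ hcls.1, by have := hcls.2; omega⟩
    | TC0 => exact ⟨h₄ _ hcls.1, by have := hcls.2; omega⟩
    | NC1 =>
      refine ⟨h₄ _ hcls.1, h₅ hcls.2.1, (h₃.trans_le hcls.2.2).trans ?_⟩
      calc d * Nat.log 2 (K * n) ≤ d * (3 * Nat.log 2 n) := Nat.mul_le_mul_left _ hlog
        _ = _ := by ring
    | NC =>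
      refine ⟨h₄ _ hcls.1, h₅ hcls.2.1, (h₃.trans_le hcls.2.2).trans ?_⟩
      calc Nat.log 2 (K * n) ^ d ≤ (3 * Nat.log 2 n) ^ d := Nat.pow_le_pow_left hlog d
        _ ≤ (Nat.log 2 n * Nat.log 2 n * Nat.log 2 n) ^ d := by
          apply Nat.pow_le_pow_left
          nlinarith
        _ = _ := by rw [pow_mul]; ring
    | PPoly => exact ⟨h₄ _ hcls.1, h₅ hcls.2⟩
  · calc C'.size = C.size := h₂
      _ ≤ (K * n) ^ k := hsize
      _ ≤ (n * n) ^ k := Nat.pow_le_pow_left (Nat.mul_le_mul_right n hKn) k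
      _ = _ := by rw [pow_mul, sq]

/-! ### The derandomized property -/

/-- Accept a truth table if the machine `A` accepts its initial segment of length
`2 ^ (log |w| / K)`, with the bits that follow as random bits, or if there are not enough
of them. -/
def acceptsPrefix (A : List Bool × List Bool → Bool) (q : Polynomial ℕ) (K : ℕ)
    (w : List Bool) : Bool :=
  -- Accepting by default keeps the property large at every length. Usefulness does not suffer, as
  -- for suitable `K` only finitely many lengths `K * n` are affected.
  if w.length < 2 ^ (Nat.log 2 w.length / K) + q.eval (2 ^ (Nat.log 2 w.length / K)) then true
  else A (w.take (2 ^ (Nat.log 2 w.length / K)),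
    (w.drop (2 ^ (Nat.log 2 w.length / K))).take (q.eval (2 ^ (Nat.log 2 w.length / K))))

/-- The property of the functions whose truth tables are accepted by `acceptsPrefix`. -/
def prefixProperty (A : List Bool × List Bool → Bool) (q : Polynomial ℕ) (K : ℕ) : BoolProperty :=
  fun n => {f | acceptsPrefix A q K (truthTable n f) = true}

theorem mem_prefixProperty {A : List Bool × List Bool → Bool} {q : Polynomial ℕ} {K m : ℕ}
    {f : BoolFun m} : f ∈ prefixProperty A q K m ↔
      (2 ^ (m / K) + q.eval (2 ^ (m / K)) ≤ 2 ^ m →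
        A ((truthTable m f).take (2 ^ (m / K)),
          ((truthTable m f).drop (2 ^ (m / K))).take (q.eval (2 ^ (m / K)))) = true) := by
  simp only [prefixProperty, acceptsPrefix, Set.mem_ofPred_eq, length_truthTable,
    Nat.log_pow one_lt_two]
  split_ifs with h
  · simp [h]
  · simp [not_lt.1 h]

/-- `acceptsPrefix` is defined on all words, so a decision procedure has to test in addition whether
the length is a power of two. -/
theorem mem_truthTableLanguage_prefixProperty {A : List Bool × List Bool → Bool}
    {q : Polynomial ℕ} {K : ℕ} {w : List Bool} :
    w ∈ truthTableLanguage (prefixProperty A q K) ↔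
      (∃ k, w.length = 2 ^ k) ∧ acceptsPrefix A q K w = true := by
  constructor
  · rintro ⟨n, f, hf, rfl⟩
    exact ⟨⟨n, length_truthTable n f⟩, hf⟩
  · rintro ⟨⟨n, hn⟩, h⟩
    obtain ⟨f, rfl⟩ := exists_truthTable_eq n w hn
    exact ⟨n, f, h, rfl⟩

theorem truthTable_mem_truthTableLanguage {P : BoolProperty} {n : ℕ} {f : BoolFun n} :
    truthTable n f ∈ truthTableLanguage P ↔ f ∈ P n := by
  constructor
  · rintro ⟨m, g, hg, h⟩
    obtain rfl : n = m := Nat.pow_right_injective le_rfl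
      (by simpa [length_truthTable] using congrArg List.length h)
    rwa [truthTable_injective n h]
  · exact fun h => ⟨n, f, h, rfl⟩

/-- Usefulness speaks of sequences with a member of the property at every `n`; this supplies the
members at small `n`. -/
theorem IsLarge.nonempty {P : BoolProperty} (hP : IsLarge P) (n : ℕ) : (P n).Nonempty := by
  obtain ⟨c, hc⟩ := hP
  by_contra hne
  have := hc n
  rw [Set.not_nonempty_iff_eq_empty.1 hne, Set.ncard_empty, Nat.cast_zero] at this
  have hpos : (0 : ℝ) < Nat.card (BoolFun n) := by exact_mod_cast Nat.card_pos
  have : 0 < (1 / 2 ^ (c * (n + 1)) : ℝ) * Nat.card (BoolFun n) := by positivity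
  linarith

/-! ### Polynomial-time decision of the derandomized property -/

section Decide

open Turing StackProgram

/-- A machine that outputs within time `t` outputs within any longer time. -/
def Turing.TM2OutputsInTime.mono {tm : FinTM2} {l : List (tm.Γ tm.k₀)}
    {o : Option (List (tm.Γ tm.k₁))} {t t' : ℕ} (h : t ≤ t') (e : TM2OutputsInTime tm l o t) :
    TM2OutputsInTime tm l o t' :=
  ⟨e.toEvalsTo, e.steps_le_m.trans h⟩

/-- The truth tables of the derandomized property are recognized in polynomial time. -/
theorem truthTableLanguage_prefixProperty_mem_classP {A : List Bool × List Bool → Bool}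
    (hA : Nonempty (TM2ComputableInPolyTime
      (Computability.encodingProd (Computability.encodingList Bool)
        (Computability.encodingList Bool)).encode Computability.encodeBool A))
    (q : Polynomial ℕ) {K : ℕ} (hK : 0 < K) :
    truthTableLanguage (prefixProperty A q K) ∈ classP := by
  classical
  obtain ⟨a⟩ := hA
  refine ⟨fun w => decide (∃ k, w.length = 2 ^ k) && acceptsPrefix A q K w, ?_, fun w => ?_⟩
  swap
  · rw [mem_truthTableLanguage_prefixProperty]
    simp
  obtain ⟨P, T, hP⟩ := exists_runs_parse a.tm hK q a.outputAlphabet.invFun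
    (fun b => a.inputAlphabet.invFun (.inl b)) (fun b => a.inputAlphabet.invFun (.inr b))
  have key : ∀ w : List Bool, Nonempty (TM2OutputsInTime (machine P .w .h) w
      (some [a.outputAlphabet.invFun
        (decide (∃ k, w.length = 2 ^ k) && acceptsPrefix A q K w)])
      ((T + a.time + 1).eval w.length)) := by
    intro w
    obtain ⟨h₁, h₂, h₃⟩ := hP w _ rfl
    simp only [Polynomial.eval_add, Polynomial.eval_one]
    by_cases hk : ∃ k, w.length = 2 ^ k
    · by_cases hlt : w.length <
          2 ^ (Nat.log 2 w.length / K) + q.eval (2 ^ (Nat.log 2 w.length / K))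
      · have hval : (decide (∃ k, w.length = 2 ^ k) && acceptsPrefix A q K w) = true := by
          simp [hk, acceptsPrefix, hlt]
        rw [hval]
        obtain ⟨e⟩ := outputs_of_halts (h₂ hk hlt)
        exact ⟨TM2OutputsInTime.mono (by omega) e⟩
      · have hval : (decide (∃ k, w.length = 2 ^ k) && acceptsPrefix A q K w) =
            A (w.take (2 ^ (Nat.log 2 w.length / K)), (w.drop (2 ^ (Nat.log 2 w.length / K))).take
              (q.eval (2 ^ (Nat.log 2 w.length / K)))) := by
          simp [hk, acceptsPrefix, hlt]
        rw [hval]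
        have hle := not_lt.1 hlt
        have ha := a.outputsFun (w.take (2 ^ (Nat.log 2 w.length / K)),
          (w.drop (2 ^ (Nat.log 2 w.length / K))).take
            (q.eval (2 ^ (Nat.log 2 w.length / K))))
        -- A pair is encoded as the concatenation of its two tagged lists, without separators, so
        -- the encoding is no longer than `w`.
        have hlen := a.time.eval_le_eval_of_le (a := ((Computability.encodingProd
          (Computability.encodingList Bool) (Computability.encodingList Bool)).encode
          (w.take (2 ^ (Nat.log 2 w.length / K)), (w.drop (2 ^ (Nat.log 2 w.length / K))).take
            (q.eval (2 ^ (Nat.log 2 w.length / K))))).length) (b := w.length) (by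
            simp [Computability.encodingProd, Computability.encodingList]; omega)
        have ha' := TM2OutputsInTime.mono hlen ha
        have hmap : ∀ x r : List Bool, ((Computability.encodingProd
            (Computability.encodingList Bool) (Computability.encodingList Bool)).encode
              (x, r)).map a.inputAlphabet.invFun =
            x.map (fun b => a.inputAlphabet.invFun (.inl b)) ++
              r.map (fun b => a.inputAlphabet.invFun (.inr b)) := by
          intro x r
          simp [Computability.encodingProd, Computability.encodingList, Function.comp_def]
        rw [hmap] at ha'
        obtain ⟨e⟩ := outputs_of_runs (h₃ hk hle) ha'
        exact ⟨TM2OutputsInTime.mono (by omega) e⟩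
    · have hval : (decide (∃ k, w.length = 2 ^ k) && acceptsPrefix A q K w) = false := by
        simp [hk]
      rw [hval]
      obtain ⟨e⟩ := outputs_of_halts (h₁ hk)
      exact ⟨TM2OutputsInTime.mono (by omega) e⟩
  exact ⟨{
    tm := machine P .w .h
    inputAlphabet := Equiv.refl Bool
    outputAlphabet := a.outputAlphabet
    time := T + a.time + 1
    outputsFun := fun w => cast (by
      congr 1
      exact (List.map_id w).symm) (key w).some }⟩

end Decide

/-! ### Choice of `K`, largeness and usefulness -/

/-- `2ⁿ` input bits and `q(2ⁿ)` random bits fit into a truth table of length `2 ^ (K n)`. -/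
theorem exists_pow_add_eval_le (q : Polynomial ℕ) :
    ∃ K > 0, ∃ n₀, ∀ n ≥ n₀, 2 ^ n + q.eval (2 ^ n) ≤ 2 ^ (K * n) := by
  set p : Polynomial ℕ := .X + q with hp
  -- The value at `1` is the sum of the coefficients, so `p(N) ≤ p(1) * N ^ deg p` for `N = 2 ^ n`.
  -- The extra factor `N` in `N ^ (deg p + 1)` exceeds `p(1)` as soon as `n ≥ p(1)`.
  refine ⟨p.natDegree + 1, Nat.succ_pos _, p.eval 1, fun n hn => ?_⟩
  have hle : p.eval (2 ^ n) ≤ p.eval 1 * (2 ^ n) ^ p.natDegree := by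
    rw [Polynomial.eval_eq_sum_range, Polynomial.eval_eq_sum_range, Finset.sum_mul]
    refine Finset.sum_le_sum fun i hi => ?_
    rw [one_pow, mul_one]
    exact Nat.mul_le_mul_left _ (Nat.pow_le_pow_right (by positivity)
      (Nat.lt_succ_iff.1 (Finset.mem_range.1 hi)))
  calc 2 ^ n + q.eval (2 ^ n) = p.eval (2 ^ n) := by simp [hp]
    _ ≤ p.eval 1 * (2 ^ n) ^ p.natDegree := hle
    _ ≤ 2 ^ n * (2 ^ n) ^ p.natDegree :=
      Nat.mul_le_mul_right _ (hn.trans Nat.lt_two_pow_self.le)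
    _ = _ := by rw [← pow_succ', ← pow_mul, mul_comm]

/-- If inputs in `P n` are accepted with probability at least `2/3`, the derandomized property
contains many functions on `m` inputs. -/
theorem card_mul_le_ncard_prefixProperty {A : List Bool × List Bool → Bool} {q : Polynomial ℕ}
    {K : ℕ} {P : BoolProperty} (hA : ∀ n, ∀ f ∈ P n, (2 / 3 : ℝ) * 2 ^ q.eval (2 ^ n) ≤
      (Finset.univ.filter fun r : Fin (q.eval (2 ^ n)) → Bool =>
        A (truthTable n f, List.ofFn r) = true).card)
    {m : ℕ} (hm : 2 ^ (m / K) + q.eval (2 ^ (m / K)) ≤ 2 ^ m) :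
    ((P (m / K)).ncard : ℝ) * (2 / 3 * 2 ^ (2 ^ m - 2 ^ (m / K))) ≤
      (prefixProperty A q K m).ncard := by
  classical
  set n := m / K with hn
  set Q := q.eval (2 ^ n) with hQ
  -- Members are glued from a table `f`, random bits `r` and padding `z`. As the blocks have fixed
  -- lengths, the gluing is injective.
  have hlen : ∀ (f : BoolFun n) (r : Fin Q → Bool) (z : Fin (2 ^ m - 2 ^ n - Q) → Bool),
      (truthTable n f ++ (List.ofFn r ++ List.ofFn z)).length = 2 ^ m := by
    intro f r z
    simp only [List.length_append, length_truthTable, List.length_ofFn]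
    omega
  choose F hF using fun f r z => exists_truthTable_eq m _ (hlen f r z)
  let S : Finset (Σ _ : BoolFun n, (Fin Q → Bool) × (Fin (2 ^ m - 2 ^ n - Q) → Bool)) :=
    (P n).toFinset.sigma fun f =>
      (Finset.univ.filter fun r => A (truthTable n f, List.ofFn r) = true) ×ˢ Finset.univ
  have hcard : S.card ≤ (prefixProperty A q K m).ncard := by
    rw [Set.ncard_eq_toFinset_card']
    refine Finset.card_le_card_of_injOn (fun s => F s.1 s.2.1 s.2.2) ?_ ?_
    · rintro ⟨f, r, z⟩ hs
      simp only [S, Finset.coe_sigma, Finset.coe_product, Set.mem_sigma_iff, Set.mem_prod,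
        Finset.mem_coe, Finset.mem_filter] at hs
      rw [Finset.mem_coe, Set.mem_toFinset, mem_prefixProperty]
      intro _
      have h₁ : (truthTable n f ++ (List.ofFn r ++ List.ofFn z)).take (2 ^ n) =
          truthTable n f := List.take_left' (length_truthTable n f)
      have h₂ : (truthTable n f ++ (List.ofFn r ++ List.ofFn z)).drop (2 ^ n) =
          List.ofFn r ++ List.ofFn z := List.drop_left' (length_truthTable n f)
      have h₃ : (List.ofFn r ++ List.ofFn z).take Q = List.ofFn r :=
        List.take_left' List.length_ofFn
      rw [hF, ← hn, h₁, h₂, ← hQ, h₃]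
      exact hs.2.1.2
    · rintro ⟨f, r, z⟩ - ⟨f', r', z'⟩ - h
      have h := congrArg (truthTable m) h
      simp only [hF] at h
      obtain ⟨h₁, h₂⟩ := List.append_inj h (by rw [length_truthTable, length_truthTable])
      obtain ⟨h₃, h₄⟩ := List.append_inj h₂ (by rw [List.length_ofFn, List.length_ofFn])
      obtain rfl := truthTable_injective n h₁
      obtain rfl := List.ofFn_injective h₃
      obtain rfl := List.ofFn_injective h₄
      rfl
  have hS : (S.card : ℝ) = ∑ f ∈ (P n).toFinset,
      ((Finset.univ.filter fun r : Fin Q → Bool =>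
        A (truthTable n f, List.ofFn r) = true).card : ℝ) * 2 ^ (2 ^ m - 2 ^ n - Q) := by
    simp [S, Finset.card_sigma, Finset.card_product]
  have hpow : (2 : ℝ) ^ (2 ^ m - 2 ^ n) = 2 ^ Q * 2 ^ (2 ^ m - 2 ^ n - Q) := by
    rw [← pow_add]
    congr 1
    omega
  calc ((P n).ncard : ℝ) * (2 / 3 * 2 ^ (2 ^ m - 2 ^ n))
      = ∑ f ∈ (P n).toFinset, (2 / 3 * 2 ^ Q * 2 ^ (2 ^ m - 2 ^ n - Q) : ℝ) := by
        rw [Finset.sum_const, nsmul_eq_mul, Set.ncard_eq_toFinset_card', hpow]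
        ring
    _ ≤ S.card := by
        rw [hS]
        refine Finset.sum_le_sum fun f hf => ?_
        exact mul_le_mul_of_nonneg_right (hA n f (Set.mem_toFinset.1 hf)) (by positivity)
    _ ≤ _ := by exact_mod_cast hcard

/-- The loss of `2/3 ≥ 1/2` costs one in the exponent, and `c * (m / K + 1) + 1 ≤ (c + 1) * (m +
1)`. Where the table is too short, the property contains all functions. -/
theorem isLarge_prefixProperty {A : List Bool × List Bool → Bool} {q : Polynomial ℕ}
    {K : ℕ} {P : BoolProperty} (hP : IsLarge P)
    (hA : ∀ n, ∀ f ∈ P n, (2 / 3 : ℝ) * 2 ^ q.eval (2 ^ n) ≤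
      (Finset.univ.filter fun r : Fin (q.eval (2 ^ n)) → Bool =>
        A (truthTable n f, List.ofFn r) = true).card) :
    IsLarge (prefixProperty A q K) := by
  obtain ⟨c, hc⟩ := hP
  have hcardBool : ∀ n, (Nat.card (BoolFun n) : ℝ) = 2 ^ 2 ^ n := by
    intro n
    simp [BoolFun]
  refine ⟨c + 1, fun m => ?_⟩
  by_cases hm : 2 ^ (m / K) + q.eval (2 ^ (m / K)) ≤ 2 ^ m
  · refine le_trans ?_ (card_mul_le_ncard_prefixProperty hA hm)
    have hn := hc (m / K)
    rw [hcardBool] at hn ⊢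
    have hpow : (2 : ℝ) ^ 2 ^ m = 2 ^ 2 ^ (m / K) * 2 ^ (2 ^ m - 2 ^ (m / K)) := by
      rw [← pow_add]
      congr 1
      omega
    have hexp : (1 / 2 ^ ((c + 1) * (m + 1)) : ℝ) ≤ 1 / 2 ^ (c * (m / K + 1)) * (2 / 3) := by
      have h₁ : (2 : ℝ) * 2 ^ (c * (m / K + 1)) ≤ 2 ^ ((c + 1) * (m + 1)) := by
        rw [← pow_succ']
        refine pow_le_pow_right₀ one_le_two ?_
        have := Nat.mul_le_mul_left c (Nat.succ_le_succ (Nat.div_le_self m K))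
        rw [add_mul, one_mul]
        simp only [Nat.succ_eq_add_one] at this
        omega
      calc (1 / 2 ^ ((c + 1) * (m + 1)) : ℝ) ≤ 1 / (2 * 2 ^ (c * (m / K + 1))) :=
            one_div_le_one_div_of_le (by positivity) h₁
        _ = 1 / 2 ^ (c * (m / K + 1)) * (1 / 2) := by rw [one_div_mul_one_div, mul_comm]
        _ ≤ _ := mul_le_mul_of_nonneg_left (by norm_num) (by positivity)
    calc (1 / 2 ^ ((c + 1) * (m + 1)) : ℝ) * 2 ^ 2 ^ m
        ≤ (1 / 2 ^ (c * (m / K + 1)) * (2 / 3)) * 2 ^ 2 ^ m := by gcongr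
      _ = (1 / 2 ^ (c * (m / K + 1)) * 2 ^ 2 ^ (m / K)) *
            (2 / 3 * 2 ^ (2 ^ m - 2 ^ (m / K))) := by rw [hpow]; ring
      _ ≤ _ := by gcongr
  · have huniv : prefixProperty A q K m = Set.univ :=
      Set.eq_univ_of_forall fun f => mem_prefixProperty.2 fun h => absurd h hm
    rw [huniv, Set.ncard_univ]
    refine mul_le_of_le_one_left (Nat.cast_nonneg _) ?_
    rw [div_le_one (by positivity)]
    exact one_le_pow₀ one_le_two

/-- A sequence `f` in the new property yields a sequence `g` in the old one, where `g n` is a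
restriction of `f (K * n)` for large `n`. Membership of `g n` rests on the one-sided error, which is
`hA`. -/
theorem isUseful_prefixProperty {𝒞 : TypicalClass} {A : List Bool × List Bool → Bool}
    {q : Polynomial ℕ} {K n₀ : ℕ} {P : BoolProperty} (hP : IsUseful 𝒞 P)
    (hne : ∀ n, (P n).Nonempty) (hK : 0 < K)
    (hn₀ : ∀ n ≥ n₀, 2 ^ n + q.eval (2 ^ n) ≤ 2 ^ (K * n))
    (hA : ∀ (n : ℕ) (f : BoolFun n) (r : List Bool), r.length = q.eval (2 ^ n) →
      A (truthTable n f, r) = true → f ∈ P n) :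
    IsUseful 𝒞 (prefixProperty A q K) := by
  intro f hf k d m hm
  have hg : ∀ n, ∃ g ∈ P n, n₀ + K + 8 ≤ n →
      ∀ k d m, 𝒞.HasCircuit d m ((K * n) ^ k) (f (K * n)) →
        𝒞.HasCircuit (3 * d) m (n ^ (2 * k)) g := by
    intro n
    by_cases hn : n₀ + K + 8 ≤ n
    · obtain ⟨g, hg, hC⟩ :=
        𝒞.exists_restriction_hasCircuit hK (by omega) (by omega : K ≤ n) (f (K * n))
      refine ⟨g, ?_, fun _ => hC⟩
      have hmem := mem_prefixProperty.1 (hf (K * n))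
      rw [Nat.mul_div_cancel_left n hK] at hmem
      have hle := hn₀ n (by omega)
      refine hA n g _ ?_ (hg ▸ hmem hle)
      rw [List.length_take, List.length_drop, length_truthTable]
      omega
    · obtain ⟨g, hg⟩ := hne n
      exact ⟨g, hg, fun h => absurd h hn⟩
  choose g hgP hgC using hg
  -- The parameters are those that restriction from `K * n` to `n` inputs produces from `k` and `d`.
  have hfreq := hP g hgP (2 * k) (3 * d) m hm
  have hfreq' := (hfreq.and_eventually (Filter.eventually_ge_atTop (n₀ + K + 8))).mono
    fun n hn h => hn.1 (hgC n hn.2 k d m h)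
  -- Since `K * n` tends to infinity with `n`, hardness at infinitely many `n` gives infinitely many
  -- input lengths.
  exact (Filter.tendsto_id.const_mul_atTop' hK).frequently hfreq'

theorem theorem1p11 (𝒞 : TypicalClass) (h : ∃ P : BoolProperty, IsNaturalProperty classRP 𝒞 P) :
    ∃ P' : BoolProperty, IsNaturalProperty classP 𝒞 P' := by
  obtain ⟨P, ⟨A, q, hA, hL⟩, hlarge, huseful⟩ := h
  obtain ⟨K, hK, n₀, hn₀⟩ := exists_pow_add_eval_le q
  refine ⟨prefixProperty A q K, truthTableLanguage_prefixProperty_mem_classP hA q hK,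
    isLarge_prefixProperty hlarge fun n f hf => ?_,
    isUseful_prefixProperty huseful hlarge.nonempty hK hn₀ fun n f r hr h => ?_⟩
  · have := (hL (truthTable n f)).1 (truthTable_mem_truthTableLanguage.2 hf)
    rwa [length_truthTable] at this
  · by_contra hf
    have := (hL (truthTable n f)).2 (mt truthTable_mem_truthTableLanguage.1 hf)
    rw [length_truthTable, ← hr] at this
    simpa [List.ofFn_get, h] using this r.get
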